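/- Let $L$ be a Lie conformal algebra over $\mathbb{C}$, with $\lambda$-bracket $[a_\lambda b]\in L[\lambda]$, that is free of finite rank $N$ as a $\mathbb{C}[\partial]$-module, with $\mathbb{C}[\partial]$-basis $u^1,\dots,u^N$. Let $R\in\mathrm{End}_{\mathbb{C}}(L)$ commute with $\partial$, and put $[a_\lambda b]_R:=[R(a)_\lambda b]+[a_\lambda R(b)]$. The endomorphism $R$ is called a *classical $R$-matrix* if $[\cdot_\lambda\cdot]_R$ is again a Lie conformal algebra bracket on the $\mathbb{C}[\partial]$-module $L$. Let $\mathcal{A}=\mathbb{C}[u^{\alpha,(n)}: 1\le\alpha\le N,\ n\ge 0]$, with $\partial u^{\alpha,(n)}=u^{\alpha,(n+1)}$, be the algebra of functions on the arc space of $\mathbb{A}^N$. A $\lambda$-bracket on $L$ is extended to $\mathcal{A}$ by the Master Formula $$\{f_\lambda g\}=\sum_{\alpha,\beta,m,n}\frac{\partial g}{\partial u^{\beta,(n)}}(\lambda+\partial)^n\{u^\alpha{}_{\lambda+\partial}u^\beta\}_\to(-\lambda-\partial)^m\frac{\partial f}{\partial u^{\alpha,(m)}} ;$$ write $\{\cdot_\lambda\cdot\}$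 and $\{\cdot_\lambda\cdot\}_R$ for the extensions of the two brackets. Let $\hat{\mathcal{A}}=\mathcal{A}\otimes\bigwedge(\theta_\alpha^{(n)}: 1\le\alpha\le N,\ n\ge 0)$, with $\theta_\alpha=\theta_\alpha^{(0)}$ and $\partial\theta_\alpha^{(n)}=\theta_\alpha^{(n+1)}$, be the algebra of functions on the arc space of $T^*[1]\mathbb{A}^N$, graded by the degree in the $\theta_\alpha^{(n)}$. It carries the degree $-1$ $\lambda$-bracket determined by $\{u^\alpha{}_\lambda\theta_\beta\}=\delta^\alpha_\beta$, $\{u^\alpha{}_\lambda u^\beta\}=\{\theta_{\alpha\,\lambda}\theta_\beta\}=0$, sesquilinearity, $\{f_\lambda gh\}=\{f_\lambda g\}h+(-1)^{(|f|+1)|g|}g\{f_\lambda h\}$ and $\{f_\lambda g\}=-(-1)^{(|f|+1)(|g|+1)}\{g_{-\lambda-\partial}f\}$. Let $\hat{\mathcal{F}}_{cl}=\hat{\mathcal{A}}/\partial\hat{\mathcal{A}}$, with quotient map $\int$ and bracket $[\int f,\int g]=\int\{f_\lambda g\}|_{\lambda=0}$ (this is well defined). Put $$P=\sum_{\alpha,\beta}\theta_\alpha\{u^\beta{}_\partial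 u^\alpha\}_{\to}\theta_\beta,\qquad P_R=\sum_{\alpha,\beta}\theta_\alpha\{u^\beta{}_\partial u^\alpha\}_{R,\to}\theta_\beta,$$ where the arrow means that $\sum_s c_s\lambda^s$ becomes the operator $\sum_s c_s\partial^s$, here acting on $\theta_\beta$. Then: 1. The map $u^\alpha\mapsto u^{\alpha,(0)}$ induces an isomorphism of differential algebras $S(L)\cong\mathcal{A}$, and under it the bracket $\{\cdot_\lambda\cdot\}$ on $\mathcal{A}$ restricts to the given $\lambda$-bracket on $L$. 2. If for some $\kappa\in\mathbb{C}$ the map $R$ satisfies the modified classical Yang–Baxter equation $[R(a)_\lambda R(b)]-R([a_\lambda b]_R)=-\kappa[a_\lambda b]$ for all $a,b\in L$ (with $R$ applied to the coefficients of the powers of $\lambda$), then $R$ is a classical $R$-matrix. 3. $P_R$ has degree $2$, and $R$ is a classical $R$-matrix if and only if $[\int P_R,\int P_R]=0$. 4. $[\int P,\int P]=0$; and, with $d_P=[\int P,-]$, $R$ is a classical $R$-matrix if and only if $\Theta_R=\int(P_R-P)$ is a Maurer–Cartan element of the dg Lie algebra $(\hat{\mathcal{F}}_{cl},[-,-],d_P)$,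 that is, $\Theta_R$ has degree $2$ and $d_P\Theta_R+\tfrac12[\Theta_R,\Theta_R]=0$. -/

import Mathlib

open scoped TensorProduct Polynomial

noncomputable section

namespace ConformalR

/-! ### Polynomials in a formal variable with coefficients in a vector space

`ℕ →₀ M` is the space `M[λ]`: the value at `n` is the coefficient of `λ ^ n`. -/

section Lambda

variable {M M' W : Type*} [AddCommGroup M] [Module ℂ M] [AddCommGroup M'] [Module ℂ M']
  [AddCommGroup W] [Module ℂ W]

/-- Multiplication by the formal variable on `M[λ]`. -/
def lam : (ℕ →₀ M) →ₗ[ℂ] (ℕ →₀ M) := Finsupp.lmapDomain M ℂ Nat.succ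

/-- A linear map applied to every coefficient. -/
def coeffwise (f : M →ₗ[ℂ] M') : (ℕ →₀ M) →ₗ[ℂ] (ℕ →₀ M') := Finsupp.mapRange.linearMap f

/-- `subst T j (∑ λ ^ n cₙ) = ∑ T ^ n (j cₙ)`: the variable is replaced by the operator `T`,
which acts on the (embedded) coefficients. -/
def subst (T : W →ₗ[ℂ] W) (j : M →ₗ[ℂ] W) : (ℕ →₀ M) →ₗ[ℂ] W :=
  Finsupp.lsum ℂ fun n => (T ^ n) ∘ₗ j

/-- The operator `λ + ∂` on `M[λ]`. -/
def lamAdd (d : M →ₗ[ℂ] M) : (ℕ →₀ M) →ₗ[ℂ] (ℕ →₀ M) := lam + coeffwise d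

/-- `p(λ) ↦ p(-λ-∂)`, where `∂` acts on the coefficients of `p`. -/
def negLamSub (d : M →ₗ[ℂ] M) : (ℕ →₀ M) →ₗ[ℂ] (ℕ →₀ M) :=
  subst (-lamAdd d) (Finsupp.lsingle 0)

end Lambda

/-! ### Lie conformal algebras and classical R-matrices -/

section LieConformal

variable {L : Type*} [AddCommGroup L] [Module ℂ L] [Module ℂ[X] L] [IsScalarTower ℂ ℂ[X] L]

variable (L) in
/-- The translation operator `∂` of a `ℂ[∂]`-module. -/
def transl : L →ₗ[ℂ] L := (LinearMap.lsmul ℂ[X] L Polynomial.X).restrictScalars ℂ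

/-- `B a b = [a_λ b]` makes the `ℂ[∂]`-module `L` a Lie conformal algebra. The Jacobi identity
is an identity in `L[λ][μ] = ℕ →₀ ℕ →₀ L`, with inner variable `λ` and outer variable `μ`. -/
structure IsLieConformal (B : L →ₗ[ℂ] L →ₗ[ℂ] (ℕ →₀ L)) : Prop where
  /-- `[∂a_λ b] = -λ[a_λ b]` -/
  sesq_left : ∀ a b, B (transl L a) b = -lam (B a b)
  /-- `[a_λ ∂b] = (λ + ∂)[a_λ b]` -/
  sesq_right : ∀ a b, B a (transl L b) = lamAdd (transl L) (B a b)
  /-- `[b_λ a] = -[a_{-λ-∂} b]` -/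
  skew : ∀ a b, B b a = -negLamSub (transl L) (B a b)
  /-- `[a_λ [b_μ c]] = [[a_λ b]_{λ+μ} c] + [b_μ [a_λ c]]` -/
  jacobi : ∀ a b c,
    coeffwise (B a) (B b c) =
      subst (coeffwise (lam (M := L)))
          (subst (coeffwise (lam (M := L)) + lam (M := ℕ →₀ L))
            (Finsupp.lsingle 0 ∘ₗ Finsupp.lsingle 0) ∘ₗ B.flip c)
          (B a b) +
        subst (coeffwise (lam (M := L))) (coeffwise (Finsupp.lsingle 0) ∘ₗ B b) (B a c)

/-- The deformed bracket `[a_λ b]_R = [R a_λ b] + [a_λ R b]`. -/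
def bracketR (B : L →ₗ[ℂ] L →ₗ[ℂ] (ℕ →₀ L)) (R : L →ₗ[ℂ] L) : L →ₗ[ℂ] L →ₗ[ℂ] (ℕ →₀ L) :=
  B ∘ₗ R + B.compl₂ R

/-- `R` is a classical R-matrix: the deformed bracket is again a Lie conformal algebra bracket
on the same `ℂ[∂]`-module. -/
def IsClassicalRMatrix (B : L →ₗ[ℂ] L →ₗ[ℂ] (ℕ →₀ L)) (R : L →ₗ[ℂ] L) : Prop :=
  IsLieConformal (bracketR B R)

/-- The modified classical Yang–Baxter equation with constant `κ`:
`[R a_λ R b] - R([R a_λ b] + [a_λ R b]) = -κ [a_λ b]` (for `κ = 0` the unmodified one). -/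
def ModifiedCYBE (κ : ℂ) (B : L →ₗ[ℂ] L →ₗ[ℂ] (ℕ →₀ L)) (R : L →ₗ[ℂ] L) : Prop :=
  ∀ a b, B (R a) (R b) - coeffwise R (bracketR B R a b) = -(κ • B a b)

variable (L) in
/-- `S(L) → S(L)[ε]`, `x ↦ x + ε ∂x` on `L`. -/
def symDual : SymmetricAlgebra ℂ L →ₐ[ℂ] DualNumber (SymmetricAlgebra ℂ L) :=
  SymmetricAlgebra.lift
    ((TrivSqZeroExt.inlAlgHom ℂ (SymmetricAlgebra ℂ L) (SymmetricAlgebra ℂ L)).toLinearMap ∘ₗ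
        SymmetricAlgebra.ι ℂ L +
      (TrivSqZeroExt.inrHom (SymmetricAlgebra ℂ L) (SymmetricAlgebra ℂ L)).restrictScalars ℂ ∘ₗ
        SymmetricAlgebra.ι ℂ L ∘ₗ transl L)

theorem fst_symDual (x : SymmetricAlgebra ℂ L) : (symDual L x).fst = x := by
  have : (TrivSqZeroExt.fstHom ℂ (SymmetricAlgebra ℂ L) (SymmetricAlgebra ℂ L)).comp (symDual L) =
      AlgHom.id ℂ _ := by
    apply SymmetricAlgebra.algHom_ext
    ext x
    simp [symDual]
  exact DFunLike.congr_fun this x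

variable (L) in
/-- The derivation of `S(L)` which extends `∂` on `L`. -/
def symDer : Derivation ℂ (SymmetricAlgebra ℂ L) (SymmetricAlgebra ℂ L) :=
  Derivation.mk'
    ((TrivSqZeroExt.sndHom (SymmetricAlgebra ℂ L) (SymmetricAlgebra ℂ L)).restrictScalars ℂ ∘ₗ
      (symDual L).toLinearMap)
    (by intro a b; simp [fst_symDual, mul_comm])

end LieConformal

/-! ### The arc space of affine space and of its shifted cotangent bundle -/

section Jets

/-- Functions on the arc space of `𝔸ᴺ`: polynomials in the jet coordinates `u^{α,(n)}`. -/
abbrev ArcAlg (N : ℕ) : Type := MvPolynomial (Fin N × ℕ) ℂ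

/-- The exterior algebra on the odd jet coordinates `θ_α^{(n)}`. -/
abbrev OddAlg (N : ℕ) : Type := ExteriorAlgebra ℂ ((Fin N × ℕ) →₀ ℂ)

/-- Functions on the arc space of `T*[1]𝔸ᴺ`. -/
abbrev HatAlg (N : ℕ) : Type := OddAlg N ⊗[ℂ] ArcAlg N

variable {N : ℕ}

/-- The translation operator on the arc space: `∂ u^{α,(n)} = u^{α,(n+1)}`. -/
def arcDer (N : ℕ) : Derivation ℂ (ArcAlg N) (ArcAlg N) :=
  MvPolynomial.mkDerivation ℂ fun i => MvPolynomial.X (i.1, i.2 + 1)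

/-- The odd coordinate `θ_α^{(n)}`. -/
def oddVar (i : Fin N × ℕ) : OddAlg N := ExteriorAlgebra.ι ℂ (Finsupp.single i 1)

/-- The shift `θ_α^{(n)} ↦ θ_α^{(n+1)}` on linear combinations of odd coordinates. -/
def oddShift (N : ℕ) : ((Fin N × ℕ) →₀ ℂ) →ₗ[ℂ] ((Fin N × ℕ) →₀ ℂ) :=
  Finsupp.lmapDomain ℂ ℂ fun i => (i.1, i.2 + 1)

/-- The algebra map `x ↦ x + ε ∂x` to dual numbers, `∂ θ_α^{(n)} = θ_α^{(n+1)}`. -/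
def oddDual (N : ℕ) : OddAlg N →ₐ[ℂ] DualNumber (OddAlg N) :=
  ExteriorAlgebra.lift ℂ
    ⟨(TrivSqZeroExt.inlAlgHom ℂ (OddAlg N) (OddAlg N)).toLinearMap ∘ₗ ExteriorAlgebra.ι ℂ +
      (TrivSqZeroExt.inrHom (OddAlg N) (OddAlg N)).restrictScalars ℂ ∘ₗ
        ExteriorAlgebra.ι ℂ ∘ₗ oddShift N, by
      intro m
      ext
      · simp
      · simp [ExteriorAlgebra.ι_add_mul_swap]⟩

/-- The even derivation of the odd coordinate algebra with `∂ θ_α^{(n)} = θ_α^{(n+1)}`. -/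
def oddDer (N : ℕ) : OddAlg N →ₗ[ℂ] OddAlg N :=
  (TrivSqZeroExt.sndHom (OddAlg N) (OddAlg N)).restrictScalars ℂ ∘ₗ (oddDual N).toLinearMap

/-- The translation operator `∂` on functions on the arc space of `T*[1]𝔸ᴺ`. -/
def hatDer (N : ℕ) : HatAlg N →ₗ[ℂ] HatAlg N :=
  (oddDer N).rTensor (ArcAlg N) + (arcDer N).toLinearMap.lTensor (OddAlg N)

/-- `∂/∂u^{α,(n)}`. -/
def dU (i : Fin N × ℕ) : HatAlg N →ₗ[ℂ] HatAlg N :=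
  (MvPolynomial.pderiv i).toLinearMap.lTensor (OddAlg N)

/-- The left derivative `∂/∂θ_α^{(n)}` on the odd coordinate algebra. -/
def dOdd (i : Fin N × ℕ) : OddAlg N →ₗ[ℂ] OddAlg N :=
  CliffordAlgebra.contractLeft (Q := (0 : QuadraticForm ℂ ((Fin N × ℕ) →₀ ℂ))) (Finsupp.lapply i)

/-- The left derivative `∂/∂θ_α^{(n)}`. -/
def dTheta (i : Fin N × ℕ) : HatAlg N →ₗ[ℂ] HatAlg N := (dOdd i).rTensor (ArcAlg N)

/-- `f ↦ (-1)^{|f|} f`. -/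
def parity (N : ℕ) : HatAlg N →ₗ[ℂ] HatAlg N :=
  (CliffordAlgebra.involute (Q := (0 : QuadraticForm ℂ ((Fin N × ℕ) →₀ ℂ)))).toLinearMap.rTensor
    (ArcAlg N)

/-- The elements of degree `p` in the odd coordinates. -/
def hatDeg (N p : ℕ) : Submodule ℂ (HatAlg N) :=
  LinearMap.range ((⋀[ℂ]^p ((Fin N × ℕ) →₀ ℂ)).subtype.rTensor (ArcAlg N))

/-! #### Leibniz rules and commutation relations -/

theorem fst_oddDual (x : OddAlg N) : (oddDual N x).fst = x := by
  have : (TrivSqZeroExt.fstHom ℂ (OddAlg N) (OddAlg N)).comp (oddDual N) = AlgHom.id ℂ _ := by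
    apply ExteriorAlgebra.hom_ext
    ext x
    simp [oddDual]
  exact DFunLike.congr_fun this x

theorem oddDer_mul (x y : OddAlg N) : oddDer N (x * y) = x * oddDer N y + oddDer N x * y := by
  simp [oddDer, fst_oddDual]

theorem oddDer_ι (v : (Fin N × ℕ) →₀ ℂ) :
    oddDer N (ExteriorAlgebra.ι ℂ v) = ExteriorAlgebra.ι ℂ (oddShift N v) := by
  simp [oddDer, oddDual]

theorem oddDer_algebraMap (r : ℂ) : oddDer N (algebraMap ℂ _ r) = 0 := by
  simp [oddDer, TrivSqZeroExt.algebraMap_eq_inl']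

theorem hatDer_tmul (x : OddAlg N) (p : ArcAlg N) :
    hatDer N (x ⊗ₜ p) = oddDer N x ⊗ₜ p + x ⊗ₜ arcDer N p := by
  simp [hatDer]

theorem hatDer_mul (f g : HatAlg N) : hatDer N (f * g) = f * hatDer N g + hatDer N f * g := by
  induction f using TensorProduct.induction_on with
  | zero => simp
  | add f f' hf hf' => simp only [add_mul, map_add, hf, hf']; abel
  | tmul x p =>
    induction g using TensorProduct.induction_on with
    | zero => simp
    | add g g' hg hg' => simp only [mul_add, map_add, hg, hg']; abel
    | tmul y q =>
      simp only [Algebra.TensorProduct.tmul_mul_tmul, hatDer_tmul, oddDer_mul, Derivation.leibniz,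
        mul_add, add_mul, TensorProduct.add_tmul, TensorProduct.tmul_add, smul_eq_mul]
      rw [mul_comm q (arcDer N p)]
      abel

theorem pderiv_arcDer_zero (σ : Fin N) (p : ArcAlg N) :
    MvPolynomial.pderiv (σ, 0) (arcDer N p) = arcDer N (MvPolynomial.pderiv (σ, 0) p) := by
  induction p using MvPolynomial.induction_on with
  | C a => simp [arcDer]
  | add p q hp hq => simp [hp, hq]
  | mul_X p i hp =>
    simp only [Derivation.leibniz, map_add, smul_eq_mul, arcDer,
      MvPolynomial.mkDerivation_X, MvPolynomial.pderiv_X]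
    have h1 : (Pi.single (σ, 0) (1 : ArcAlg N) : (Fin N × ℕ) → ArcAlg N) (i.1, i.2 + 1) = 0 := by
      simp
    have h2 : MvPolynomial.mkDerivation ℂ (fun i : Fin N × ℕ => (MvPolynomial.X (i.1, i.2 + 1) :
        ArcAlg N)) ((Pi.single (σ, 0) (1 : ArcAlg N) : (Fin N × ℕ) → ArcAlg N) i) = 0 := by
      rw [Pi.single_apply]; split_ifs <;> simp
    simp only [arcDer] at hp
    rw [h1, h2, hp]
    ring

theorem pderiv_arcDer_succ (σ : Fin N) (n : ℕ) (p : ArcAlg N) :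
    MvPolynomial.pderiv (σ, n + 1) (arcDer N p) =
      arcDer N (MvPolynomial.pderiv (σ, n + 1) p) + MvPolynomial.pderiv (σ, n) p := by
  induction p using MvPolynomial.induction_on with
  | C a => simp [arcDer]
  | add p q hp hq => simp only [map_add, hp, hq]; abel
  | mul_X p i hp =>
    simp only [Derivation.leibniz, map_add, smul_eq_mul, arcDer,
      MvPolynomial.mkDerivation_X, MvPolynomial.pderiv_X]
    have h1 : (Pi.single (σ, n + 1) (1 : ArcAlg N) : (Fin N × ℕ) → ArcAlg N) (i.1, i.2 + 1) =
        (Pi.single (σ, n) (1 : ArcAlg N) : (Fin N × ℕ) → ArcAlg N) i := by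
      simp [Pi.single_apply, Prod.ext_iff]
    have h2 : MvPolynomial.mkDerivation ℂ (fun i : Fin N × ℕ => (MvPolynomial.X (i.1, i.2 + 1) :
        ArcAlg N)) ((Pi.single (σ, n + 1) (1 : ArcAlg N) : (Fin N × ℕ) → ArcAlg N) i) = 0 := by
      rw [Pi.single_apply]; split_ifs <;> simp
    simp only [arcDer] at hp
    rw [h1, h2, hp]
    ring

theorem dOdd_ι_mul (i : Fin N × ℕ) (v : (Fin N × ℕ) →₀ ℂ) (x : OddAlg N) :
    dOdd i (ExteriorAlgebra.ι ℂ v * x) = v i • x - ExteriorAlgebra.ι ℂ v * dOdd i x :=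
  CliffordAlgebra.contractLeft_ι_mul (Q := 0) _ v x

theorem dOdd_algebraMap (i : Fin N × ℕ) (r : ℂ) : dOdd i (algebraMap ℂ (OddAlg N) r) = 0 :=
  CliffordAlgebra.contractLeft_algebraMap _ _ r

theorem odd_induction {P : OddAlg N → Prop} (algebraMap : ∀ r : ℂ, P (algebraMap ℂ _ r))
    (add : ∀ x y, P x → P y → P (x + y))
    (ι_mul : ∀ x v, P x → P (ExteriorAlgebra.ι ℂ v * x)) (x : OddAlg N) : P x :=
  CliffordAlgebra.left_induction (Q := 0) (P := P) algebraMap add ι_mul x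

theorem oddShift_zero (σ : Fin N) (v : (Fin N × ℕ) →₀ ℂ) : oddShift N v (σ, 0) = 0 := by
  simp only [oddShift, Finsupp.lmapDomain_apply]
  apply Finsupp.mapDomain_of_notMem_range
  simp

theorem oddShift_succ (σ : Fin N) (n : ℕ) (v : (Fin N × ℕ) →₀ ℂ) :
    oddShift N v (σ, n + 1) = v (σ, n) := by
  simp only [oddShift, Finsupp.lmapDomain_apply]
  exact Finsupp.mapDomain_apply (f := fun i : Fin N × ℕ => (i.1, i.2 + 1))
    (by rintro ⟨a, b⟩ ⟨c, d⟩ h; simpa using h) v (σ, n)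

theorem dOdd_oddDer_zero (σ : Fin N) (x : OddAlg N) :
    dOdd (σ, 0) (oddDer N x) = oddDer N (dOdd (σ, 0) x) := by
  induction x using odd_induction with
  | algebraMap r => simp [oddDer_algebraMap, dOdd_algebraMap]
  | add x y hx hy => simp [hx, hy]
  | ι_mul x v hx =>
    simp only [oddDer_mul, oddDer_ι, map_add, map_sub, dOdd_ι_mul, map_smul, hx, oddShift_zero,
      zero_smul]
    abel

theorem dOdd_oddDer_succ (σ : Fin N) (n : ℕ) (x : OddAlg N) :
    dOdd (σ, n + 1) (oddDer N x) = oddDer N (dOdd (σ, n + 1) x) + dOdd (σ, n) x := by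
  induction x using odd_induction with
  | algebraMap r => simp [oddDer_algebraMap, dOdd_algebraMap]
  | add x y hx hy => simp only [map_add, hx, hy]; abel
  | ι_mul x v hx =>
    simp only [oddDer_mul, oddDer_ι, map_add, map_sub, dOdd_ι_mul, map_smul, hx, oddShift_succ,
      mul_add]
    abel

theorem dU_tmul (i : Fin N × ℕ) (x : OddAlg N) (p : ArcAlg N) :
    dU i (x ⊗ₜ p) = x ⊗ₜ MvPolynomial.pderiv i p := by simp [dU]

theorem dTheta_tmul (i : Fin N × ℕ) (x : OddAlg N) (p : ArcAlg N) :
    dTheta i (x ⊗ₜ p) = dOdd i x ⊗ₜ p := by simp [dTheta]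

theorem dU_hatDer_zero (σ : Fin N) (f : HatAlg N) :
    dU (σ, 0) (hatDer N f) = hatDer N (dU (σ, 0) f) := by
  induction f using TensorProduct.induction_on with
  | zero => simp
  | add f g hf hg => simp [hf, hg]
  | tmul x p => simp [hatDer_tmul, dU_tmul, pderiv_arcDer_zero]

theorem dU_hatDer_succ (σ : Fin N) (n : ℕ) (f : HatAlg N) :
    dU (σ, n + 1) (hatDer N f) = hatDer N (dU (σ, n + 1) f) + dU (σ, n) f := by
  induction f using TensorProduct.induction_on with
  | zero => simp
  | add f g hf hg => simp only [map_add, hf, hg]; abel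
  | tmul x p =>
    simp only [hatDer_tmul, dU_tmul, map_add, pderiv_arcDer_succ, TensorProduct.tmul_add]
    abel

theorem dTheta_hatDer_zero (σ : Fin N) (f : HatAlg N) :
    dTheta (σ, 0) (hatDer N f) = hatDer N (dTheta (σ, 0) f) := by
  induction f using TensorProduct.induction_on with
  | zero => simp
  | add f g hf hg => simp [hf, hg]
  | tmul x p => simp [hatDer_tmul, dTheta_tmul, dOdd_oddDer_zero]

theorem dTheta_hatDer_succ (σ : Fin N) (n : ℕ) (f : HatAlg N) :
    dTheta (σ, n + 1) (hatDer N f) = hatDer N (dTheta (σ, n + 1) f) + dTheta (σ, n) f := by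
  induction f using TensorProduct.induction_on with
  | zero => simp
  | add f g hf hg => simp only [map_add, hf, hg]; abel
  | tmul x p =>
    simp only [hatDer_tmul, dTheta_tmul, map_add, dOdd_oddDer_succ, TensorProduct.add_tmul]
    abel

theorem parity_hatDer (f : HatAlg N) : parity N (hatDer N f) = hatDer N (parity N f) := by
  have key : ∀ x : OddAlg N, CliffordAlgebra.involute (oddDer N x) =
      oddDer N (CliffordAlgebra.involute x) := by
    intro x
    induction x using odd_induction with
    | algebraMap r => simp [oddDer_algebraMap]
    | add x y hx hy => simp [hx, hy]
    | ι_mul x v hx =>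
      have h : ∀ w : (Fin N × ℕ) →₀ ℂ, CliffordAlgebra.involute (ExteriorAlgebra.ι ℂ w) =
          -ExteriorAlgebra.ι ℂ w := fun w => CliffordAlgebra.involute_ι w
      simp [oddDer_mul, oddDer_ι, hx, h, add_comm]
  induction f using TensorProduct.induction_on with
  | zero => simp
  | add f g hf hg => simp [hf, hg]
  | tmul x p => simp [hatDer_tmul, parity, key]

/-! #### Symbols of derivatives -/

theorem arc_finite (σ : Fin N) (p : ArcAlg N) :
    (Function.support fun n : ℕ => MvPolynomial.pderiv (σ, n) p).Finite := by
  refine ((p.vars.image Prod.snd).finite_toSet).subset fun n hn => ?_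
  by_contra h
  refine hn (MvPolynomial.pderiv_eq_zero_of_notMem_vars fun hm => h ?_)
  simpa using ⟨σ, hm⟩

theorem dU_finite (σ : Fin N) (f : HatAlg N) :
    (Function.support fun n : ℕ => dU (σ, n) f).Finite := by
  induction f using TensorProduct.induction_on with
  | zero => simp
  | add f g hf hg =>
    refine (hf.union hg).subset fun n hn => ?_
    by_contra h
    simp only [Set.mem_union, Function.mem_support, not_or, not_not] at h
    exact hn (by simp [h.1, h.2])
  | tmul x p =>
    refine (arc_finite σ p).subset fun n hn h => hn ?_
    simp only at h
    simp [dU_tmul, h]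

theorem dOdd_finite (σ : Fin N) (x : OddAlg N) :
    (Function.support fun n : ℕ => dOdd (σ, n) x).Finite := by
  induction x using odd_induction with
  | algebraMap r => simp [dOdd_algebraMap]
  | add f g hf hg =>
    refine (hf.union hg).subset fun n hn => ?_
    by_contra h
    simp only [Set.mem_union, Function.mem_support, not_or, not_not] at h
    exact hn (by simp [h.1, h.2])
  | ι_mul x v hx =>
    refine (hx.union (v.support.image Prod.snd).finite_toSet).subset fun n hn => ?_
    by_contra h
    simp only [Set.mem_union, Function.mem_support, not_or, not_not] at h
    refine hn ?_
    have hv : v (σ, n) = 0 := by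
      by_contra hv
      exact h.2 (by simpa using ⟨σ, hv⟩)
    simp [dOdd_ι_mul, h.1, hv]

theorem dTheta_finite (σ : Fin N) (f : HatAlg N) :
    (Function.support fun n : ℕ => dTheta (σ, n) f).Finite := by
  induction f using TensorProduct.induction_on with
  | zero => simp
  | add f g hf hg =>
    refine (hf.union hg).subset fun n hn => ?_
    by_contra h
    simp only [Set.mem_union, Function.mem_support, not_or, not_not] at h
    exact hn (by simp [h.1, h.2])
  | tmul x p =>
    refine (dOdd_finite σ x).subset fun n hn h => hn ?_
    simp only at h
    simp [dTheta_tmul, h]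

/-- `∑ₙ λ ^ n ∂f/∂u^{σ,(n)}` for a function `f` on the arc space of `𝔸ᴺ`. -/
def arcGrad (σ : Fin N) : ArcAlg N →ₗ[ℂ] (ℕ →₀ ArcAlg N) where
  toFun f := Finsupp.ofSupportFinite (fun n => MvPolynomial.pderiv (σ, n) f) (arc_finite σ f)
  map_add' f g := by ext1 n; simp [Finsupp.ofSupportFinite_coe]
  map_smul' c f := by ext1 n; simp [Finsupp.ofSupportFinite_coe]

/-- `∑ₙ λ ^ n ∂f/∂u^{σ,(n)}`. -/
def gradU (σ : Fin N) : HatAlg N →ₗ[ℂ] (ℕ →₀ HatAlg N) where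
  toFun f := Finsupp.ofSupportFinite (fun n => dU (σ, n) f) (dU_finite σ f)
  map_add' f g := by ext1 n; simp [Finsupp.ofSupportFinite_coe]
  map_smul' c f := by ext1 n; simp [Finsupp.ofSupportFinite_coe]

/-- `∑ₙ λ ^ n ∂f/∂θ_σ^{(n)}`. -/
def gradTheta (σ : Fin N) : HatAlg N →ₗ[ℂ] (ℕ →₀ HatAlg N) where
  toFun f := Finsupp.ofSupportFinite (fun n => dTheta (σ, n) f) (dTheta_finite σ f)
  map_add' f g := by ext1 n; simp [Finsupp.ofSupportFinite_coe]
  map_smul' c f := by ext1 n; simp [Finsupp.ofSupportFinite_coe]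

theorem lam_zero {M : Type*} [AddCommGroup M] [Module ℂ M] (p : ℕ →₀ M) : lam p 0 = 0 := by
  simp only [lam, Finsupp.lmapDomain_apply]
  exact Finsupp.mapDomain_of_notMem_range _ _ (by simp)

theorem lam_succ {M : Type*} [AddCommGroup M] [Module ℂ M] (p : ℕ →₀ M) (n : ℕ) :
    lam p (n + 1) = p n := by
  simp only [lam, Finsupp.lmapDomain_apply]
  exact Finsupp.mapDomain_apply Nat.succ_injective p n

theorem gradU_hatDer (σ : Fin N) (f : HatAlg N) :
    gradU σ (hatDer N f) = lamAdd (hatDer N) (gradU σ f) := by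
  ext1 n
  cases n with
  | zero => simp [gradU, Finsupp.ofSupportFinite_coe, lamAdd, lam_zero, coeffwise, dU_hatDer_zero]
  | succ n =>
    simp [gradU, Finsupp.ofSupportFinite_coe, lamAdd, lam_succ, coeffwise, dU_hatDer_succ, add_comm]

theorem gradTheta_hatDer (σ : Fin N) (f : HatAlg N) :
    gradTheta σ (hatDer N f) = lamAdd (hatDer N) (gradTheta σ f) := by
  ext1 n
  cases n with
  | zero =>
    simp [gradTheta, Finsupp.ofSupportFinite_coe, lamAdd, lam_zero, coeffwise, dTheta_hatDer_zero]
  | succ n =>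
    simp [gradTheta, Finsupp.ofSupportFinite_coe, lamAdd, lam_succ, coeffwise, dTheta_hatDer_succ,
      add_comm]

end Jets

/-! ### Master formula -/

section Master

variable {S : Type*} [Ring S] [Algebra ℂ S]

/-- `(w, ∑ λ ^ n hₙ) ↦ ∑ₙ ((λ + ∂) ^ n w) hₙ`, for `w` and `∑ λ ^ n hₙ` in `S[λ]`. -/
def actOn (d : S →ₗ[ℂ] S) : (ℕ →₀ S) →ₗ[ℂ] (ℕ →₀ S) →ₗ[ℂ] (ℕ →₀ S) :=
  LinearMap.mk₂ ℂ
    (fun w q => q.sum fun n h => coeffwise (LinearMap.mulRight ℂ h) ((lamAdd d ^ n) w))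
    (by
      intro w w' q
      simp [Finsupp.sum, Finset.sum_add_distrib])
    (by
      intro c w q
      simp [Finsupp.sum, Finset.smul_sum])
    (by
      intro w q q'
      refine Finsupp.sum_add_index' ?_ ?_
      · intro n; ext k; simp [coeffwise]
      · intro n h h'; ext k; simp [coeffwise, mul_add])
    (by
      intro c w q
      rw [Finsupp.sum_smul_index' (by intro n; ext k; simp [coeffwise]), Finsupp.smul_sum]
      refine Finsupp.sum_congr fun n _ => ?_
      ext k
      simp [coeffwise])

theorem lam_single {M : Type*} [AddCommGroup M] [Module ℂ M] (n : ℕ) (m : M) :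
    lam (Finsupp.single n m) = Finsupp.single (n + 1) m := by
  simp [lam]

theorem lam_coeffwise {M M' : Type*} [AddCommGroup M] [Module ℂ M] [AddCommGroup M'] [Module ℂ M']
    (f : M →ₗ[ℂ] M') (p : ℕ →₀ M) : lam (coeffwise f p) = coeffwise f (lam p) := by
  induction p using Finsupp.induction_linear with
  | zero => simp
  | add p q hp hq => simp [hp, hq]
  | single n m => simp [lam_single, coeffwise]

theorem lam_lamAdd {M : Type*} [AddCommGroup M] [Module ℂ M] (d : M →ₗ[ℂ] M) (p : ℕ →₀ M) :
    lam (lamAdd d p) = lamAdd d (lam p) := by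
  simp [lamAdd, lam_coeffwise]

theorem coeffwise_lamAdd {M : Type*} [AddCommGroup M] [Module ℂ M] (d : M →ₗ[ℂ] M) (p : ℕ →₀ M) :
    coeffwise d (lamAdd d p) = lamAdd d (coeffwise d p) := by
  simp [lamAdd, lam_coeffwise]

theorem negLamSub_lamAdd {M : Type*} [AddCommGroup M] [Module ℂ M] (d : M →ₗ[ℂ] M) (p : ℕ →₀ M) :
    negLamSub d (lamAdd d p) = -lam (negLamSub d p) := by
  induction p using Finsupp.induction_linear with
  | zero => simp
  | add p q hp hq => simp only [map_add, hp, hq, neg_add]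
  | single n m =>
    have hc : Commute (coeffwise d) (-lamAdd d) := by
      have : Commute (coeffwise d) (lamAdd d) := LinearMap.ext fun p => coeffwise_lamAdd d p
      exact Commute.neg_right (R := Module.End ℂ (ℕ →₀ M)) this
    have h := DFunLike.congr_fun (hc.pow_right n).eq (Finsupp.single 0 m)
    simp only [Module.End.mul_apply] at h
    have h0 : (Finsupp.single 0 (d m) : ℕ →₀ M) = coeffwise d (Finsupp.single 0 m) := by
      simp [coeffwise]
    have e : lamAdd d (Finsupp.single n m) = Finsupp.single (n + 1) m + Finsupp.single n (d m) := by
      simp [lamAdd, lam_single, coeffwise]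
    have hs : ∀ (k : ℕ) (x : M), negLamSub d (Finsupp.single k x) =
        ((-lamAdd d) ^ k) (Finsupp.single 0 x) := by
      intro k x; simp [negLamSub, subst]
    rw [e, map_add, hs, hs, hs, h0, ← h, pow_succ']
    simp only [Module.End.mul_apply, LinearMap.neg_apply, lamAdd, LinearMap.add_apply]
    abel

theorem actOn_single (d : S →ₗ[ℂ] S) (w : ℕ →₀ S) (n : ℕ) (h : S) :
    actOn d w (Finsupp.single n h) = coeffwise (LinearMap.mulRight ℂ h) ((lamAdd d ^ n) w) := by
  simp only [actOn, LinearMap.mk₂_apply]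
  refine Finsupp.sum_single_index ?_
  ext k
  simp [coeffwise]

theorem actOn_lam (d : S →ₗ[ℂ] S) (w q : ℕ →₀ S) : actOn d (lam w) q = lam (actOn d w q) := by
  have hc : Commute (lam (M := S)) (lamAdd d) :=
    LinearMap.ext fun p => lam_lamAdd d p
  induction q using Finsupp.induction_linear with
  | zero => simp
  | add p q hp hq => simp only [map_add, hp, hq]
  | single n h =>
    have h := DFunLike.congr_fun (hc.pow_right n).eq w
    simp only [Module.End.mul_apply] at h
    rw [actOn_single, actOn_single, lam_coeffwise, h]

theorem actOn_neg_lam (d : S →ₗ[ℂ] S) (w q : ℕ →₀ S) :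
    actOn d (-lam w) q = -lam (actOn d w q) := by
  rw [map_neg, LinearMap.neg_apply, actOn_lam]

theorem actOn_lamAdd (d : S →ₗ[ℂ] S) (hd : ∀ a b, d (a * b) = a * d b + d a * b)
    (w q : ℕ →₀ S) : actOn d w (lamAdd d q) = lamAdd d (actOn d w q) := by
  have key : ∀ (v : ℕ →₀ S) (h : S), lamAdd d (coeffwise (LinearMap.mulRight ℂ h) v) =
      coeffwise (LinearMap.mulRight ℂ h) (lamAdd d v) +
        coeffwise (LinearMap.mulRight ℂ (d h)) v := by
    intro v h
    simp only [lamAdd, LinearMap.add_apply, lam_coeffwise, map_add, add_assoc]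
    congr 1
    ext k
    simp [coeffwise, hd, add_comm]
  induction q using Finsupp.induction_linear with
  | zero => simp
  | add p q hp hq => simp only [map_add, hp, hq]
  | single n h =>
    have e : lamAdd d (Finsupp.single n h) = Finsupp.single (n + 1) h + Finsupp.single n (d h) := by
      simp [lamAdd, lam_single, coeffwise]
    rw [e, map_add, actOn_single, actOn_single, actOn_single, key, pow_succ', Module.End.mul_apply]

end Master

/-! ### The Poisson vertex algebra structure on `S(L) = O((𝔸ᴺ)_∞)` -/

section PVA

variable {L : Type*} [AddCommGroup L] [Module ℂ L] [Module ℂ[X] L] [IsScalarTower ℂ ℂ[X] L]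
  {N : ℕ}

/-- The embedding of `L` in the functions on the arc space of `𝔸ᴺ` given by a `ℂ[∂]`-basis `b`:
`∂ ^ n b_α ↦ u^{α,(n)}`. -/
def jetEmb (b : Module.Basis (Fin N) ℂ[X] L) : L →ₗ[ℂ] ArcAlg N :=
  ∑ α, (Polynomial.basisMonomials ℂ).constr ℂ (fun n => (MvPolynomial.X (α, n) : ArcAlg N)) ∘ₗ
    (b.coord α).restrictScalars ℂ

/-- The extension of the `λ`-bracket `B` of `L` to functions on the arc space by the Master Formula
`{f_λ g} = ∑ ∂g/∂u^{β,(n)} (λ+∂)^n {u^α_{λ+∂} u^β}_→ (-λ-∂)^m ∂f/∂u^{α,(m)}`. -/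
def pvaBracket (B : L →ₗ[ℂ] L →ₗ[ℂ] (ℕ →₀ L)) (b : Module.Basis (Fin N) ℂ[X] L)
    (f g : ArcAlg N) : ℕ →₀ ArcAlg N :=
  ∑ α, ∑ β,
    actOn (arcDer N).toLinearMap
      (actOn (arcDer N).toLinearMap
        (negLamSub (arcDer N).toLinearMap (arcGrad α f))
        (coeffwise (jetEmb b) (B (b α) (b β))))
      (arcGrad β g)

/-- The coordinate function `θ_α^{(n)}`. -/
def theta (i : Fin N × ℕ) : HatAlg N := oddVar i ⊗ₜ 1

/-- Functions on the arc space of `𝔸ᴺ` as functions of odd degree `0`. -/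
def ofArc (N : ℕ) : ArcAlg N →ₐ[ℂ] HatAlg N := Algebra.TensorProduct.includeRight

/-- `P = ∑ θ_α {u^β_∂ u^α}_→ θ_β`, where `{u^β_λ u^α} = ∑ λ ^ s cₛ` becomes the operator
`∑ cₛ ∂ ^ s` acting on `θ_β`. -/
def bivector (B : L →ₗ[ℂ] L →ₗ[ℂ] (ℕ →₀ L)) (b : Module.Basis (Fin N) ℂ[X] L) : HatAlg N :=
  ∑ α, ∑ β, theta (α, 0) *
    (pvaBracket B b (MvPolynomial.X (β, 0)) (MvPolynomial.X (α, 0))).sum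
      fun s c => ofArc N c * theta (β, s)

end PVA

/-! ### Local functionals -/

section Functionals

variable {N : ℕ}

/-- `{f_λ u^σ} = (-1)^{|f|} {u^σ_{-λ-∂} f}`. -/
def bracketWithU (σ : Fin N) : HatAlg N →ₗ[ℂ] (ℕ →₀ HatAlg N) :=
  negLamSub (hatDer N) ∘ₗ gradTheta σ ∘ₗ parity N

/-- `{f_λ θ_σ} = -{θ_σ_{-λ-∂} f}`. -/
def bracketWithTheta (σ : Fin N) : HatAlg N →ₗ[ℂ] (ℕ →₀ HatAlg N) :=
  negLamSub (hatDer N) ∘ₗ gradU σ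

/-- The `λ`-bracket `{f_λ g}` of degree `-1` on functions on the arc space of `T*[1]𝔸ᴺ`: the
sesquilinear extension of `{u^α_λ θ_β} = δ^α_β`, `{u^α_λ u^β} = {θ_α_λ θ_β} = 0` with
`{f_λ gh} = {f_λ g}h + (-1)^{(|f|+1)|g|} g{f_λ h}` and
`{f_λ g} = -(-1)^{(|f|+1)(|g|+1)} {g_{-λ-∂} f}`, that is
`{f_λ g} = ∑ ((λ+∂)^n {f_λ u^σ}) ∂g/∂u^{σ,(n)} + ∑ ((λ+∂)^n {f_λ θ_σ}) ∂g/∂θ_σ^{(n)}`. -/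
def chiralBracket (N : ℕ) : HatAlg N →ₗ[ℂ] HatAlg N →ₗ[ℂ] (ℕ →₀ HatAlg N) :=
  ∑ σ, ((actOn (hatDer N)).compl₁₂ (bracketWithU σ) (gradU σ) +
    (actOn (hatDer N)).compl₁₂ (bracketWithTheta σ) (gradTheta σ))

theorem chiralBracket_apply (f g : HatAlg N) : chiralBracket N f g =
    ∑ σ, (actOn (hatDer N) (bracketWithU σ f) (gradU σ g) +
      actOn (hatDer N) (bracketWithTheta σ f) (gradTheta σ g)) := by
  simp [chiralBracket, LinearMap.sum_apply]

theorem chiralBracket_der_left (f g : HatAlg N) :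
    chiralBracket N (hatDer N f) g = -lam (chiralBracket N f g) := by
  simp only [chiralBracket_apply, bracketWithU, bracketWithTheta, LinearMap.comp_apply,
    parity_hatDer, gradU_hatDer, gradTheta_hatDer, negLamSub_lamAdd, map_sum, map_add]
  rw [← Finset.sum_neg_distrib]
  refine Finset.sum_congr rfl fun σ _ => ?_
  rw [neg_add, actOn_neg_lam, actOn_neg_lam]

theorem chiralBracket_der_right (f g : HatAlg N) :
    chiralBracket N f (hatDer N g) = lamAdd (hatDer N) (chiralBracket N f g) := by
  simp [chiralBracket_apply, gradU_hatDer, gradTheta_hatDer, actOn_lamAdd _ hatDer_mul]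

/-- The space of local functionals: functions modulo total derivatives. -/
abbrev LocalFunctional (N : ℕ) : Type := HatAlg N ⧸ LinearMap.range (hatDer N)

/-- The quotient map `f ↦ ∫ f`. -/
def integral (N : ℕ) : HatAlg N →ₗ[ℂ] LocalFunctional N := (LinearMap.range (hatDer N)).mkQ

/-- Local functionals of degree `p`. -/
def functionalDeg (N p : ℕ) : Submodule ℂ (LocalFunctional N) := (hatDeg N p).map (integral N)

/-- The bracket of local functionals, `[∫ f, ∫ g] = ∫ {f_λ g}|_{λ = 0}`. -/
def functionalBracket (N : ℕ) :
    LocalFunctional N →ₗ[ℂ] LocalFunctional N →ₗ[ℂ] LocalFunctional N :=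
  (LinearMap.range (hatDer N)).liftQ
    (((LinearMap.range (hatDer N)).liftQ
      (((chiralBracket N).compr₂ (integral N ∘ₗ Finsupp.lapply 0)).flip)
      (by
        rintro _ ⟨g, rfl⟩
        rw [LinearMap.mem_ker]
        refine LinearMap.ext fun f => ?_
        simp only [LinearMap.flip_apply, LinearMap.compr₂_apply, LinearMap.comp_apply,
          Finsupp.lapply_apply, chiralBracket_der_right, LinearMap.zero_apply]
        refine (Submodule.Quotient.mk_eq_zero _).2 ⟨chiralBracket N f g 0, ?_⟩
        simp [lamAdd, lam_zero, coeffwise])).flip)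
    (by
      rintro _ ⟨f, rfl⟩
      rw [LinearMap.mem_ker]
      refine LinearMap.ext fun x => ?_
      obtain ⟨g, rfl⟩ := Submodule.Quotient.mk_surjective _ x
      change integral N (chiralBracket N (hatDer N f) g 0) = 0
      simp [chiralBracket_der_left, lam_zero])

theorem functionalBracket_integral (f g : HatAlg N) :
    functionalBracket N (integral N f) (integral N g) = integral N (chiralBracket N f g 0) := rfl

/-- `Θ` is a Maurer–Cartan element of the dg Lie algebra of local functionals with bracket
`[·,·]` and differential `d_P = [P, ·]`. The Lie degree is one less than the degree in the odd
coordinates, so that Maurer–Cartan elements have degree `2`. -/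
def IsMaurerCartan (P Θ : LocalFunctional N) : Prop :=
  Θ ∈ functionalDeg N 2 ∧
    functionalBracket N P Θ + (1 / 2 : ℂ) • functionalBracket N Θ Θ = 0

end Functionals

end ConformalR

end

/-! Since `R` commutes with `∂`, the deformed bracket is automatically sesquilinear and skew, so
being a classical R-matrix is the Jacobi identity for it. The Jacobiator is itself sesquilinear in
its three arguments, so it suffices to test it on the `ℂ[∂]`-basis (`isLieConformal_iff`). Under the
modified Yang–Baxter equation the Jacobiator of the deformed bracket is a combination of Jacobiators
of the original one.

For any skew sesquilinear bracket with bivector `P`, the Jacobi identity is equivalent to `[∫P, ∫P]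
= 0`; this is applied to both brackets. The bracket of local functionals is expressed by variational
derivatives, and skewness of the λ-bracket, read as skew-adjointness of the operators `{u^β_∂ u^α}`,
gives `[∫P, ∫P] = -4 ∫T` for a cubic function `T` (`functionalBracket_bivector`). Homogeneity of `T`
in the odd variables gives `3 ∫T = ∫ ∑ θ_σ δT/δθ_σ`, while variational derivatives kill total
derivatives; hence `∫T = 0` exactly when every `δT/δθ_ρ` vanishes. Finally `δT/δθ_ρ` is the sum over
`γ, β` of the Jacobiators of `b_γ, b_β, b_ρ`, with `λ` and `μ` acting as `∂` on `θ_γ` and `θ_β`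
(`varTheta_trivector`). The coefficients are recovered by second derivatives in the odd variables,
up to a factor 2 due to skew-symmetry of the Jacobiator.

The Maurer–Cartan statement is then algebra: as `[∫P, ∫P] = 0` and the bracket is symmetric on even
functions, its left-hand side equals `½ [∫P_R, ∫P_R]`. -/

noncomputable section

namespace ConformalR

/-! ### Jet coordinates, the isomorphism `S(L) ≅ 𝒜`, and the Master Formula on `L`. -/

section Generators

variable {L : Type*} [AddCommGroup L] [Module ℂ L] [Module ℂ[X] L] [IsScalarTower ℂ ℂ[X] L]
  {N : ℕ}

theorem transl_apply (a : L) : transl L a = (Polynomial.X : ℂ[X]) • a := rfl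

/-- The `ℂ`-basis `∂ ^ n b_α` of a free `ℂ[∂]`-module. -/
def jetBasis (b : Module.Basis (Fin N) ℂ[X] L) : Module.Basis (Fin N × ℕ) ℂ L :=
  (Polynomial.basisMonomials ℂ).smulTower' b

theorem jetBasis_apply (b : Module.Basis (Fin N) ℂ[X] L) (i : Fin N × ℕ) :
    jetBasis b i = (Polynomial.X ^ i.2 : ℂ[X]) • b i.1 := by
  simp [jetBasis, Module.Basis.smulTower'_apply, Polynomial.X_pow_eq_monomial]

theorem jetBasis_zero (b : Module.Basis (Fin N) ℂ[X] L) (α : Fin N) :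
    jetBasis b (α, 0) = b α := by
  simp [jetBasis_apply]

theorem transl_jetBasis (b : Module.Basis (Fin N) ℂ[X] L) (α : Fin N) (n : ℕ) :
    transl L (jetBasis b (α, n)) = jetBasis b (α, n + 1) := by
  simp [jetBasis_apply, transl_apply, smul_smul, pow_succ']

/-- Two linear maps which intertwine `∂` with the same operator agree if they agree on a
`ℂ[∂]`-basis. -/
theorem ext_of_transl {W : Type*} [AddCommGroup W] [Module ℂ W]
    (b : Module.Basis (Fin N) ℂ[X] L) {f g : L →ₗ[ℂ] W} (T : W → W)
    (hf : ∀ a, f (transl L a) = T (f a)) (hg : ∀ a, g (transl L a) = T (g a))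
    (h : ∀ α, f (b α) = g (b α)) : f = g := by
  refine (jetBasis b).ext ?_
  rintro ⟨α, n⟩
  induction n with
  | zero => simpa [jetBasis_zero] using h α
  | succ n ih => rw [← transl_jetBasis, hf, hg, ih]

theorem jetEmb_jetBasis (b : Module.Basis (Fin N) ℂ[X] L) (i : Fin N × ℕ) :
    jetEmb b (jetBasis b i) = MvPolynomial.X i := by
  classical
  obtain ⟨α, n⟩ := i
  have h : ∀ β, ((Polynomial.basisMonomials ℂ).constr ℂ
      (fun n => (MvPolynomial.X (β, n) : ArcAlg N))) (b.coord β (jetBasis b (α, n))) =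
      if β = α then MvPolynomial.X (α, n) else 0 := by
    intro β
    rw [jetBasis_apply, map_smul, Module.Basis.coord_apply, Module.Basis.repr_self]
    by_cases hb : β = α
    · subst hb
      have := (Polynomial.basisMonomials ℂ).constr_basis ℂ
        (fun n => (MvPolynomial.X (β, n) : ArcAlg N)) n
      simpa [Polynomial.X_pow_eq_monomial] using this
    · rw [Finsupp.single_eq_of_ne hb]
      simp [hb]
  simp only [jetEmb, LinearMap.sum_apply, LinearMap.comp_apply, LinearMap.restrictScalars_apply, h]
  simp

theorem jetEmb_basis (b : Module.Basis (Fin N) ℂ[X] L) (α : Fin N) :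
    jetEmb b (b α) = MvPolynomial.X (α, 0) := by
  rw [← jetBasis_zero, jetEmb_jetBasis]

theorem jetEmb_transl (b : Module.Basis (Fin N) ℂ[X] L) (a : L) :
    jetEmb b (transl L a) = arcDer N (jetEmb b a) := by
  have : jetEmb b ∘ₗ transl L = (arcDer N).toLinearMap ∘ₗ jetEmb b := by
    refine (jetBasis b).ext ?_
    rintro ⟨α, n⟩
    simp [transl_jetBasis, jetEmb_jetBasis, arcDer]
  exact DFunLike.congr_fun this a

theorem jetEmb_injective (b : Module.Basis (Fin N) ℂ[X] L) : Function.Injective (jetEmb b) := by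
  have h : jetEmb b = (Finsupp.linearCombination ℂ (fun i => (MvPolynomial.X i : ArcAlg N))) ∘ₗ
      (jetBasis b).repr.toLinearMap := by
    refine (jetBasis b).ext fun i => ?_
    simp [jetEmb_jetBasis]
  rw [h]
  rw [LinearMap.coe_comp]
  exact Function.Injective.comp (MvPolynomial.linearIndependent_X (Fin N × ℕ) ℂ)
    (jetBasis b).repr.injective

theorem symDer_ι (a : L) :
    symDer L (SymmetricAlgebra.ι ℂ L a) = SymmetricAlgebra.ι ℂ L (transl L a) := by
  simp [symDer, symDual]

/-- `S(L) ≅ 𝒜` as differential algebras. -/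
theorem exists_symmetricAlgebra_equiv (b : Module.Basis (Fin N) ℂ[X] L) :
    ∃ e : SymmetricAlgebra ℂ L ≃ₐ[ℂ] ArcAlg N,
      (∀ a, e (SymmetricAlgebra.ι ℂ L a) = jetEmb b a) ∧
      ∀ v, e (symDer L v) = arcDer N (e v) := by
  let e := SymmetricAlgebra.equivMvPolynomial (jetBasis b)
  have he : ∀ a, e (SymmetricAlgebra.ι ℂ L a) = jetEmb b a := by
    intro a
    have : e.toLinearMap ∘ₗ SymmetricAlgebra.ι ℂ L = jetEmb b := by
      refine (jetBasis b).ext fun i => ?_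
      rw [jetEmb_jetBasis]
      exact SymmetricAlgebra.equivMvPolynomial_ι_apply (jetBasis b) i
    exact DFunLike.congr_fun this a
  refine ⟨e, he, fun v => ?_⟩
  induction v using SymmetricAlgebra.induction with
  | algebraMap r => simp
  | ι a => rw [symDer_ι, he, he, jetEmb_transl]
  | mul x y hx hy => simp [Derivation.leibniz, hx, hy]
  | add x y hx hy => simp [hx, hy]

theorem arcGrad_arcDer (σ : Fin N) (f : ArcAlg N) :
    arcGrad σ (arcDer N f) = lamAdd (arcDer N).toLinearMap (arcGrad σ f) := by
  ext1 n
  cases n with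
  | zero =>
    simp [arcGrad, Finsupp.ofSupportFinite_coe, lamAdd, lam_zero, coeffwise, pderiv_arcDer_zero]
  | succ n =>
    simp [arcGrad, Finsupp.ofSupportFinite_coe, lamAdd, lam_succ, coeffwise, pderiv_arcDer_succ,
      add_comm]

theorem arcGrad_X_zero (σ α : Fin N) :
    arcGrad σ (MvPolynomial.X (α, 0)) = if σ = α then Finsupp.single 0 1 else 0 := by
  classical
  ext1 n
  simp only [arcGrad, Finsupp.ofSupportFinite_coe, LinearMap.coe_mk, AddHom.coe_mk,
    MvPolynomial.pderiv_X]
  split_ifs with h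
  · subst h
    cases n <;> simp
  · have : (α, 0) ≠ (σ, n) := fun e => h (by simp_all)
    simp [this]

theorem lamAdd_pow_single_zero_one {S : Type*} [Ring S] [Algebra ℂ S] (d : S →ₗ[ℂ] S)
    (hd : d 1 = 0) (n : ℕ) :
    (lamAdd d ^ n) (Finsupp.single 0 1) = Finsupp.single n 1 := by
  induction n with
  | zero => simp
  | succ n ih =>
    rw [pow_succ', Module.End.mul_apply, ih]
    simp [lamAdd, lam_single, coeffwise, hd]

theorem actOn_one_left {S : Type*} [Ring S] [Algebra ℂ S] (d : S →ₗ[ℂ] S) (hd : d 1 = 0)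
    (q : ℕ →₀ S) : actOn d (Finsupp.single 0 1) q = q := by
  induction q using Finsupp.induction_linear with
  | zero => simp
  | add p q hp hq => simp only [map_add, hp, hq]
  | single n h =>
    rw [actOn_single, lamAdd_pow_single_zero_one d hd]
    simp [coeffwise]

theorem actOn_one_right {S : Type*} [Ring S] [Algebra ℂ S] (d : S →ₗ[ℂ] S) (q : ℕ →₀ S) :
    actOn d q (Finsupp.single 0 1) = q := by
  rw [actOn_single]
  ext
  simp [coeffwise]

theorem negLamSub_single_zero {M : Type*} [AddCommGroup M] [Module ℂ M] (d : M →ₗ[ℂ] M) (m : M) :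
    negLamSub d (Finsupp.single 0 m) = Finsupp.single 0 m := by
  simp [negLamSub, subst]

theorem pvaBracket_X_zero (B : L →ₗ[ℂ] L →ₗ[ℂ] (ℕ →₀ L)) (b : Module.Basis (Fin N) ℂ[X] L)
    (α β : Fin N) :
    pvaBracket B b (MvPolynomial.X (α, 0)) (MvPolynomial.X (β, 0)) =
      coeffwise (jetEmb b) (B (b α) (b β)) := by
  classical
  have h1 : (arcDer N).toLinearMap 1 = 0 := by simp
  unfold pvaBracket
  rw [Finset.sum_eq_single α, Finset.sum_eq_single β]
  · simp [arcGrad_X_zero, actOn_one_left _ h1, actOn_one_right, negLamSub_single_zero]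
  · intro γ _ hγ
    simp [arcGrad_X_zero, hγ]
  · simp
  · intro γ _ hγ
    simp [arcGrad_X_zero, hγ]
  · simp

theorem coeffwise_lamAdd_of_comm {M M' : Type*} [AddCommGroup M] [Module ℂ M] [AddCommGroup M']
    [Module ℂ M'] {d : M →ₗ[ℂ] M} {d' : M' →ₗ[ℂ] M'} {j : M →ₗ[ℂ] M'}
    (hj : ∀ x, j (d x) = d' (j x)) (p : ℕ →₀ M) :
    coeffwise j (lamAdd d p) = lamAdd d' (coeffwise j p) := by
  simp only [lamAdd, LinearMap.add_apply, map_add, lam_coeffwise]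
  congr 1
  ext k
  simp [coeffwise, hj]

/-- Only sesquilinearity matters: both sides obey the same rules for `∂` in each argument, and on
basis vectors the gradients in the Master Formula are Kronecker deltas. -/
theorem pvaBracket_jetEmb {B : L →ₗ[ℂ] L →ₗ[ℂ] (ℕ →₀ L)}
    (hl : ∀ a c, B (transl L a) c = -lam (B a c))
    (hr : ∀ a c, B a (transl L c) = lamAdd (transl L) (B a c))
    (b : Module.Basis (Fin N) ℂ[X] L) (a c : L) :
    pvaBracket B b (jetEmb b a) (jetEmb b c) = coeffwise (jetEmb b) (B a c) := by
  have hd : ∀ x y : ArcAlg N, (arcDer N).toLinearMap (x * y) =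
      x * (arcDer N).toLinearMap y + (arcDer N).toLinearMap x * y := by
    intro x y; simp [mul_comm]
  let V : L →ₗ[ℂ] L →ₗ[ℂ] (ℕ →₀ ArcAlg N) :=
    ∑ α, ∑ β, (actOn (arcDer N).toLinearMap).compl₁₂
      ((actOn (arcDer N).toLinearMap).flip (coeffwise (jetEmb b) (B (b α) (b β))) ∘ₗ
        negLamSub (arcDer N).toLinearMap ∘ₗ arcGrad α ∘ₗ jetEmb b) (arcGrad β ∘ₗ jetEmb b)
  have hV : ∀ a c, V a c = pvaBracket B b (jetEmb b a) (jetEmb b c) := by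
    intro a c; simp [V, pvaBracket, LinearMap.sum_apply]
  let U : L →ₗ[ℂ] L →ₗ[ℂ] (ℕ →₀ ArcAlg N) := B.compr₂ (coeffwise (jetEmb b))
  have key : V = U := by
    -- Reduction in the first argument, where `∂` acts as `-λ`; the second, where it acts as `λ +
    -- ∂`, is reduced below.
    refine ext_of_transl b (fun f => -(lam ∘ₗ f)) (fun a => ?_) (fun a => ?_) fun α => ?_
    · refine LinearMap.ext fun c => ?_
      simp only [hV, LinearMap.neg_apply, LinearMap.comp_apply, pvaBracket, jetEmb_transl,
        arcGrad_arcDer, negLamSub_lamAdd, map_neg, LinearMap.neg_apply, actOn_lam,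
        map_sum, Finset.sum_neg_distrib]
    · refine LinearMap.ext fun c => ?_
      simp [U, hl, lam_coeffwise]
    · refine ext_of_transl b (lamAdd (arcDer N).toLinearMap) (fun c => ?_) (fun c => ?_) fun β => ?_
      · simp only [hV, pvaBracket, jetEmb_transl, arcGrad_arcDer, actOn_lamAdd _ hd, map_sum]
      · simp [U, hr, coeffwise_lamAdd_of_comm (d' := (arcDer N).toLinearMap) (jetEmb_transl b)]
      · simp [hV, U, jetEmb_basis, pvaBracket_X_zero]
  rw [← hV, key]
  rfl

end Generators

/-! ### The modified classical Yang–Baxter equation implies the Jacobi identity. -/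

section YangBaxter

variable {L : Type*} [AddCommGroup L] [Module ℂ L]

/-- The term `[a_λ [b_μ c]]` of the Jacobi identity, linear in `q = [b_μ c]`. -/
def jacobiLeft (B : L →ₗ[ℂ] L →ₗ[ℂ] (ℕ →₀ L)) (a : L) (q : ℕ →₀ L) : ℕ →₀ ℕ →₀ L :=
  coeffwise (B a) q

/-- The term `[[a_λ b]_{λ+μ} c]` of the Jacobi identity, linear in `q = [a_λ b]`. -/
def jacobiMid (B : L →ₗ[ℂ] L →ₗ[ℂ] (ℕ →₀ L)) (c : L) (q : ℕ →₀ L) : ℕ →₀ ℕ →₀ L :=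
  subst (coeffwise (lam (M := L)))
    (subst (coeffwise (lam (M := L)) + lam (M := ℕ →₀ L))
      (Finsupp.lsingle 0 ∘ₗ Finsupp.lsingle 0) ∘ₗ B.flip c) q

/-- The term `[b_μ [a_λ c]]` of the Jacobi identity, linear in `q = [a_λ c]`. -/
def jacobiRight (B : L →ₗ[ℂ] L →ₗ[ℂ] (ℕ →₀ L)) (b : L) (q : ℕ →₀ L) : ℕ →₀ ℕ →₀ L :=
  subst (coeffwise (lam (M := L))) (coeffwise (Finsupp.lsingle 0) ∘ₗ B b) q

/-- The difference of the two sides of the Jacobi identity. -/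
def jacobiator (B : L →ₗ[ℂ] L →ₗ[ℂ] (ℕ →₀ L)) (a b c : L) : ℕ →₀ ℕ →₀ L :=
  jacobiLeft B a (B b c) - (jacobiMid B c (B a b) + jacobiRight B b (B a c))

section

variable {M M' M'' : Type*} [AddCommGroup M] [Module ℂ M] [AddCommGroup M'] [Module ℂ M']
  [AddCommGroup M''] [Module ℂ M'']

theorem coeffwise_comp (f : M' →ₗ[ℂ] M'') (g : M →ₗ[ℂ] M') (p : ℕ →₀ M) :
    coeffwise f (coeffwise g p) = coeffwise (f ∘ₗ g) p := by
  ext k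
  simp [coeffwise]

theorem coeffwise_add (f g : M →ₗ[ℂ] M') : coeffwise (f + g) = coeffwise f + coeffwise g := by
  ext : 3
  simp [coeffwise]

theorem subst_single (T : M' →ₗ[ℂ] M') (j : M →ₗ[ℂ] M') (n : ℕ) (m : M) :
    subst T j (Finsupp.single n m) = (T ^ n) (j m) := by
  simp [subst]

theorem subst_coeffwise (T : M'' →ₗ[ℂ] M'') (j : M' →ₗ[ℂ] M'') (g : M →ₗ[ℂ] M') (p : ℕ →₀ M) :
    subst T j (coeffwise g p) = subst T (j ∘ₗ g) p := by
  induction p using Finsupp.induction_linear with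
  | zero => simp
  | add p q hp hq => simp only [map_add, hp, hq]
  | single n m => simp [coeffwise, subst_single]

theorem subst_add (T : M' →ₗ[ℂ] M') (j j' : M →ₗ[ℂ] M') :
    subst T (j + j') = subst T j + subst T j' := by
  ext : 2
  simp [subst_single]

end

section

variable (B : L →ₗ[ℂ] L →ₗ[ℂ] (ℕ →₀ L)) (R : L →ₗ[ℂ] L)

theorem bracketR_apply (a c : L) : bracketR B R a c = B (R a) c + B a (R c) := by
  simp [bracketR]

theorem jacobiLeft_bracketR (a : L) (q : ℕ →₀ L) :
    jacobiLeft (bracketR B R) a q = jacobiLeft B (R a) q + jacobiLeft B a (coeffwise R q) := by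
  have : bracketR B R a = B (R a) + B a ∘ₗ R := by ext : 1; simp [bracketR_apply]
  simp [jacobiLeft, this, coeffwise_add, coeffwise_comp]

theorem jacobiMid_bracketR (c : L) (q : ℕ →₀ L) :
    jacobiMid (bracketR B R) c q = jacobiMid B (R c) q + jacobiMid B c (coeffwise R q) := by
  have : (bracketR B R).flip c = B.flip (R c) + B.flip c ∘ₗ R := by
    ext : 1; simp [bracketR_apply, add_comm]
  simp [jacobiMid, this, LinearMap.comp_add, subst_add, subst_coeffwise, LinearMap.comp_assoc]

theorem jacobiRight_bracketR (c : L) (q : ℕ →₀ L) :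
    jacobiRight (bracketR B R) c q = jacobiRight B (R c) q + jacobiRight B c (coeffwise R q) := by
  have : bracketR B R c = B (R c) + B c ∘ₗ R := by ext : 1; simp [bracketR_apply]
  simp [jacobiRight, this, LinearMap.comp_add, subst_add, subst_coeffwise, LinearMap.comp_assoc]

end

variable [Module ℂ[X] L] [IsScalarTower ℂ ℂ[X] L]
  {B : L →ₗ[ℂ] L →ₗ[ℂ] (ℕ →₀ L)} {R : L →ₗ[ℂ] L}

theorem jacobiator_eq_zero (hB : IsLieConformal B) (a b c : L) :
    jacobiator B a b c = 0 :=
  sub_eq_zero.2 (hB.jacobi a b c)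

/-- The axioms of a Lie conformal algebra other than the Jacobi identity. -/
structure IsSkewSesquilinear (B : L →ₗ[ℂ] L →ₗ[ℂ] (ℕ →₀ L)) : Prop where
  sesq_left : ∀ a b, B (transl L a) b = -lam (B a b)
  sesq_right : ∀ a b, B a (transl L b) = lamAdd (transl L) (B a b)
  skew : ∀ a b, B b a = -negLamSub (transl L) (B a b)

theorem IsLieConformal.isSkewSesquilinear (hB : IsLieConformal B) : IsSkewSesquilinear B :=
  ⟨hB.sesq_left, hB.sesq_right, hB.skew⟩

theorem IsSkewSesquilinear.isLieConformal (hB : IsSkewSesquilinear B)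
    (h : ∀ a b c, jacobiator B a b c = 0) : IsLieConformal B :=
  ⟨hB.sesq_left, hB.sesq_right, hB.skew, fun a b c => sub_eq_zero.1 (h a b c)⟩

/-- Leaves the Jacobi identity as the only condition in the definition of a classical R-matrix. -/
theorem IsSkewSesquilinear.bracketR (hB : IsSkewSesquilinear B)
    (hR : ∀ a, R (transl L a) = transl L (R a)) : IsSkewSesquilinear (bracketR B R) where
  sesq_left a c := by simp only [bracketR_apply, hR, hB.sesq_left, map_add, neg_add]
  sesq_right a c := by simp only [bracketR_apply, hR, hB.sesq_right, map_add]
  skew a c := by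
    rw [bracketR_apply, bracketR_apply, hB.skew (R a) c, hB.skew a (R c), map_add]
    abel

/-- Solutions of the modified classical Yang–Baxter equation are classical R-matrices. -/
theorem ModifiedCYBE.isClassicalRMatrix (hB : IsLieConformal B)
    (hR : ∀ a, R (transl L a) = transl L (R a)) {κ : ℂ} (h : ModifiedCYBE κ B R) :
    IsClassicalRMatrix B R := by
  refine (hB.isSkewSesquilinear.bracketR hR).isLieConformal fun x y z => ?_
  have hY : ∀ a c, coeffwise R (ConformalR.bracketR B R a c) = B (R a) (R c) + κ • B a c := by
    intro a c
    rw [← sub_eq_iff_eq_add', ← neg_sub, h a c, neg_neg]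
  have hl : ∀ a p q, jacobiLeft B a (p + q) = jacobiLeft B a p + jacobiLeft B a q := by
    intro a p q; simp [jacobiLeft]
  have hm : ∀ a p q, jacobiMid B a (p + q) = jacobiMid B a p + jacobiMid B a q := by
    intro a p q; simp [jacobiMid]
  have hr : ∀ a p q, jacobiRight B a (p + q) = jacobiRight B a p + jacobiRight B a q := by
    intro a p q; simp [jacobiRight]
  have hl' : ∀ a p, jacobiLeft B a (κ • p) = κ • jacobiLeft B a p := by
    intro a p; simp [jacobiLeft]
  have hm' : ∀ a p, jacobiMid B a (κ • p) = κ • jacobiMid B a p := by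
    intro a p; simp [jacobiMid]
  have hr' : ∀ a p, jacobiRight B a (κ • p) = κ • jacobiRight B a p := by
    intro a p; simp [jacobiRight]
  -- Each nested deformed bracket has an outer term with `R` applied to an inner deformed bracket.
  -- The Yang–Baxter equation rewrites it as `[R·, R·] + κ[·,·]`, so that in every nested bracket
  -- two of `x, y, z` carry `R`, apart from the `κ` terms.
  have key : jacobiator (ConformalR.bracketR B R) x y z = jacobiator B (R x) (R y) z +
      jacobiator B (R x) y (R z) + jacobiator B x (R y) (R z) + κ • jacobiator B x y z := by
    simp only [jacobiator, jacobiLeft_bracketR, jacobiMid_bracketR, jacobiRight_bracketR, hY]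
    simp only [bracketR_apply, hl, hm, hr, hl', hm', hr', smul_sub, smul_add]
    abel
  simp [key, jacobiator_eq_zero hB]

end YangBaxter

/-! ### Symmetry and sesquilinearity of the Jacobiator; reduction to a basis. -/

section Jacobiator

section

variable {M M' : Type*} [AddCommGroup M] [Module ℂ M] [AddCommGroup M'] [Module ℂ M']

theorem coeffwise_single (f : M →ₗ[ℂ] M') (n : ℕ) (m : M) :
    coeffwise f (Finsupp.single n m) = Finsupp.single n (f m) := by
  simp [coeffwise]

theorem coeffwise_smul (c : ℂ) (f : M →ₗ[ℂ] M') : coeffwise (c • f) = c • coeffwise f := by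
  ext : 3
  simp [coeffwise]

theorem subst_smul (T : M' →ₗ[ℂ] M') (c : ℂ) (j : M →ₗ[ℂ] M') :
    subst T (c • j) = c • subst T j := by
  ext : 2
  simp [subst_single]

theorem subst_neg (T : M' →ₗ[ℂ] M') (j : M →ₗ[ℂ] M') : subst T (-j) = -subst T j := by
  ext : 2
  simp [subst_single]

theorem subst_lam (T : M' →ₗ[ℂ] M') (j : M →ₗ[ℂ] M') (p : ℕ →₀ M) :
    subst T j (lam p) = T (subst T j p) := by
  induction p using Finsupp.induction_linear with
  | zero => simp
  | add p q hp hq => simp only [map_add, hp, hq]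
  | single n m => simp [lam_single, subst_single, pow_succ']

theorem subst_comp_of_comm {T S : M' →ₗ[ℂ] M'} (h : Commute T S) (j : M →ₗ[ℂ] M') (p : ℕ →₀ M) :
    subst T (S ∘ₗ j) p = S (subst T j p) := by
  induction p using Finsupp.induction_linear with
  | zero => simp
  | add p q hp hq => simp only [map_add, hp, hq]
  | single n m =>
    have := DFunLike.congr_fun (h.pow_left n).eq (j m)
    simpa [subst_single] using this

variable (M) in
/-- The exchange of the two variables of `M[λ][μ]`. -/
def swapVar : (ℕ →₀ ℕ →₀ M) →ₗ[ℂ] (ℕ →₀ ℕ →₀ M) :=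
  Finsupp.lsum ℂ fun m => coeffwise (Finsupp.lsingle m)

theorem swapVar_single (m n : ℕ) (x : M) :
    swapVar M (Finsupp.single m (Finsupp.single n x)) = Finsupp.single n (Finsupp.single m x) := by
  simp [swapVar, coeffwise]

theorem swapVar_lam (p : ℕ →₀ ℕ →₀ M) :
    swapVar M (lam p) = coeffwise lam (swapVar M p) := by
  have : swapVar M ∘ₗ lam = coeffwise lam ∘ₗ swapVar M := by
    ext : 4
    simp [lam_single, swapVar_single, coeffwise_single]
  exact DFunLike.congr_fun this p

theorem swapVar_coeffwise_lam (p : ℕ →₀ ℕ →₀ M) :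
    swapVar M (coeffwise lam p) = lam (swapVar M p) := by
  have : swapVar M ∘ₗ coeffwise lam = lam ∘ₗ swapVar M := by
    ext : 4
    simp [lam_single, swapVar_single, coeffwise_single]
  exact DFunLike.congr_fun this p

theorem swapVar_coeffwise (d : M →ₗ[ℂ] M) (p : ℕ →₀ ℕ →₀ M) :
    swapVar M (coeffwise (coeffwise d) p) = coeffwise (coeffwise d) (swapVar M p) := by
  have : swapVar M ∘ₗ coeffwise (coeffwise d) = coeffwise (coeffwise d) ∘ₗ swapVar M := by
    ext : 4
    simp [swapVar_single, coeffwise_single]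
  exact DFunLike.congr_fun this p

theorem swapVar_swapVar (p : ℕ →₀ ℕ →₀ M) : swapVar M (swapVar M p) = p := by
  have : swapVar M ∘ₗ swapVar M = LinearMap.id := by
    ext : 4
    simp [swapVar_single]
  exact DFunLike.congr_fun this p

theorem swapVar_apply (p : ℕ →₀ ℕ →₀ M) (m n : ℕ) : swapVar M p m n = p n m := by
  induction p using Finsupp.induction_linear with
  | zero => simp
  | add p q hp hq => simp [hp, hq]
  | single k p =>
    induction p using Finsupp.induction_linear with
    | zero => simp
    | add p q hp hq => simp_all [Finsupp.single_add]
    | single l x =>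
      classical
      rw [swapVar_single]
      simp only [Finsupp.single_apply]
      split_ifs <;> simp_all

theorem commute_lam_coeffwise (f : M →ₗ[ℂ] M) : Commute (coeffwise f) (lam (M := M)) :=
  LinearMap.ext fun p => (lam_coeffwise f p).symm

end

variable {L : Type*} [AddCommGroup L] [Module ℂ L] (B : L →ₗ[ℂ] L →ₗ[ℂ] (ℕ →₀ L))

/-- The two nested terms differ by exchanging `λ` and `μ`, so every later computation with the right
term reduces to the left one. -/
theorem jacobiRight_eq_swapVar (a : L) (q : ℕ →₀ L) :
    jacobiRight B a q = swapVar L (jacobiLeft B a q) := by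
  have hp : ∀ (n : ℕ) (p : ℕ →₀ L), ((coeffwise (lam (M := L))) ^ n)
      (coeffwise (Finsupp.lsingle 0) p) = swapVar L (Finsupp.single n p) := by
    intro n p
    induction n with
    | zero => simp [swapVar]
    | succ n ih => rw [pow_succ', Module.End.mul_apply, ih, ← swapVar_lam, lam_single]
  unfold jacobiRight jacobiLeft
  induction q using Finsupp.induction_linear with
  | zero => simp
  | add p q hp hq => simp only [map_add, hp, hq]
  | single n m => simp [subst_single, coeffwise_single, hp]

/-- `[x_{λ+μ} c]`. -/
def bracketSum (c : L) : L →ₗ[ℂ] (ℕ →₀ ℕ →₀ L) :=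
  subst (coeffwise (lam (M := L)) + lam (M := ℕ →₀ L))
      (Finsupp.lsingle 0 ∘ₗ Finsupp.lsingle 0) ∘ₗ B.flip c

theorem jacobiMid_eq (c : L) (q : ℕ →₀ L) :
    jacobiMid B c q = subst (coeffwise lam) (bracketSum B c) q := rfl

/-- The expression depends on the variables only through `λ + μ`. -/
theorem swapVar_bracketSum (c x : L) : swapVar L (bracketSum B c x) = bracketSum B c x := by
  simp only [bracketSum, LinearMap.comp_apply]
  generalize B.flip c x = q
  have hp : ∀ (n : ℕ) (p : ℕ →₀ ℕ →₀ L), swapVar L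
      (((coeffwise (lam (M := L)) + lam (M := ℕ →₀ L)) ^ n) p) =
        ((coeffwise (lam (M := L)) + lam (M := ℕ →₀ L)) ^ n) (swapVar L p) := by
    intro n p
    induction n with
    | zero => simp
    | succ n ih =>
      rw [pow_succ', Module.End.mul_apply, Module.End.mul_apply, ← ih]
      simp [swapVar_lam, swapVar_coeffwise_lam, add_comm]
  induction q using Finsupp.induction_linear with
  | zero => simp
  | add p q hp hq => simp only [map_add, hp, hq]
  | single n m => simp [subst_single, hp, swapVar_single]

theorem jacobiMid_lam (c : L) (q : ℕ →₀ L) :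
    jacobiMid B c (lam q) = coeffwise lam (jacobiMid B c q) := by
  simp [jacobiMid_eq, subst_lam]

theorem isLinearMap_jacobiator_left (b c : L) : IsLinearMap ℂ fun a => jacobiator B a b c where
  map_add x y := by
    simp only [jacobiator, jacobiLeft, jacobiMid, jacobiRight, map_add, coeffwise_add,
      LinearMap.add_apply]
    abel
  map_smul k x := by
    simp only [jacobiator, jacobiLeft, jacobiMid, jacobiRight, map_smul, coeffwise_smul,
      LinearMap.smul_apply, smul_sub, smul_add]

theorem isLinearMap_jacobiator_mid (a c : L) : IsLinearMap ℂ fun b => jacobiator B a b c where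
  map_add x y := by
    simp only [jacobiator, jacobiLeft, jacobiMid, jacobiRight, map_add, subst_add,
      LinearMap.comp_add, LinearMap.add_apply]
    abel
  map_smul k x := by
    simp only [jacobiator, jacobiLeft, jacobiMid, jacobiRight, map_smul, subst_smul,
      LinearMap.comp_smul, LinearMap.smul_apply, smul_sub, smul_add]

theorem isLinearMap_jacobiator_right (a b : L) : IsLinearMap ℂ fun c => jacobiator B a b c where
  map_add x y := by
    simp only [jacobiator, jacobiLeft, jacobiMid, jacobiRight, map_add, subst_add,
      LinearMap.comp_add, LinearMap.add_apply]
    abel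
  map_smul k x := by
    simp only [jacobiator, jacobiLeft, jacobiMid, jacobiRight, map_smul, subst_smul,
      LinearMap.comp_smul, LinearMap.smul_apply, smul_sub, smul_add]

variable {B} [Module ℂ[X] L] [IsScalarTower ℂ ℂ[X] L]

variable (L) in
/-- The operator `λ + μ + ∂` on `L[λ][μ]`. -/
def lamMuAdd : (ℕ →₀ ℕ →₀ L) →ₗ[ℂ] (ℕ →₀ ℕ →₀ L) :=
  coeffwise lam + lam + coeffwise (coeffwise (transl L))

theorem IsSkewSesquilinear.bracketSum_transl_left (hB : IsSkewSesquilinear B) (c x : L) :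
    bracketSum B c (transl L x) = -(coeffwise lam (bracketSum B c x) + lam (bracketSum B c x)) := by
  simp [bracketSum, hB.sesq_left, subst_lam]

theorem IsSkewSesquilinear.bracketSum_transl_right (hB : IsSkewSesquilinear B) (c : L) :
    bracketSum B (transl L c) = lamMuAdd L ∘ₗ
      bracketSum B c := by
  refine LinearMap.ext fun x => ?_
  have h : Commute (coeffwise (lam (M := L)) + lam (M := ℕ →₀ L))
      (coeffwise (coeffwise (transl L))) := by
    refine Commute.add_left ?_ (commute_lam_coeffwise _).symm
    refine LinearMap.ext fun p => ?_
    simp only [Module.End.mul_apply, coeffwise_comp]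
    congr 2
    exact LinearMap.ext fun p => lam_coeffwise _ p
  have e : (Finsupp.lsingle 0 ∘ₗ Finsupp.lsingle 0) ∘ₗ transl L =
      coeffwise (coeffwise (transl L)) ∘ₗ
        ((Finsupp.lsingle 0 : (ℕ →₀ L) →ₗ[ℂ] _) ∘ₗ (Finsupp.lsingle 0 : L →ₗ[ℂ] (ℕ →₀ L))) := by
    ext : 1
    simp [coeffwise_single]
  simp only [bracketSum, LinearMap.comp_apply, LinearMap.flip_apply, hB.sesq_right, lamAdd,
    LinearMap.add_apply, map_add, subst_lam, subst_coeffwise, e, subst_comp_of_comm h,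
    lamMuAdd]

/-- Inside `[·_{λ+μ} c]` the operator `∂` becomes `-(λ + μ)`, so `λ + ∂` becomes `-μ`. -/
theorem IsSkewSesquilinear.jacobiMid_lamAdd (hB : IsSkewSesquilinear B) (c : L) (q : ℕ →₀ L) :
    jacobiMid B c (lamAdd (transl L) q) = -lam (jacobiMid B c q) := by
  have e : bracketSum B c ∘ₗ transl L = -((coeffwise lam + lam) ∘ₗ bracketSum B c) := by
    ext1 x
    simp [hB.bracketSum_transl_left]
  have h : Commute (coeffwise (lam (M := L))) (coeffwise (lam (M := L)) + lam (M := ℕ →₀ L)) :=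
    Commute.add_right (Commute.refl _) (commute_lam_coeffwise _)
  simp only [jacobiMid_eq, lamAdd, LinearMap.add_apply, map_add, subst_lam, subst_coeffwise, e,
    subst_neg, subst_comp_of_comm h, LinearMap.neg_apply]
  abel

/-- Skewness replaces `λ` by `-λ-∂`, which acts as `μ` inside `[·_{λ+μ} c]`: this exchanges the two
variables. -/
theorem IsSkewSesquilinear.jacobiMid_swap (hB : IsSkewSesquilinear B) (a b c : L) :
    jacobiMid B c (B b a) = -swapVar L (jacobiMid B c (B a b)) := by
  rw [hB.skew a b]
  have hn : ∀ q, jacobiMid B c (-q) = -jacobiMid B c q := by intro q; simp [jacobiMid]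
  rw [hn]
  congr 1
  generalize B a b = q
  have hp : ∀ (n : ℕ) (x : L), jacobiMid B c (((-lamAdd (transl L)) ^ n) (Finsupp.single 0 x)) =
      swapVar L (((coeffwise (lam (M := L))) ^ n) (bracketSum B c x)) := by
    intro n x
    induction n with
    | zero => simp [jacobiMid_eq, subst_single, swapVar_bracketSum]
    | succ n ih =>
      rw [pow_succ', pow_succ', Module.End.mul_apply, Module.End.mul_apply, LinearMap.neg_apply,
        hn, hB.jacobiMid_lamAdd, neg_neg, ih, swapVar_coeffwise_lam]
  simp only [jacobiMid_eq] at hp ⊢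
  induction q using Finsupp.induction_linear with
  | zero => simp
  | add p q hp hq => simp only [map_add, hp, hq]
  | single n m => simp only [negLamSub, subst_single, Finsupp.lsingle_apply, hp]

/-- The Jacobiator is skew-symmetric in its first two arguments. -/
theorem IsSkewSesquilinear.jacobiator_swap (hB : IsSkewSesquilinear B) (a b c : L) :
    jacobiator B b a c = -swapVar L (jacobiator B a b c) := by
  simp only [jacobiator, jacobiRight_eq_swapVar, hB.jacobiMid_swap a b c, map_sub, map_add,
    swapVar_swapVar]
  abel

theorem IsSkewSesquilinear.jacobiator_transl_left (hB : IsSkewSesquilinear B) (a b c : L) :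
    jacobiator B (transl L a) b c = -coeffwise lam (jacobiator B a b c) := by
  have hl : B (transl L a) = (-lam) ∘ₗ B a := by ext1 x; simp [hB.sesq_left]
  have hn : ∀ q, jacobiMid B c (-q) = -jacobiMid B c q := by intro q; simp [jacobiMid]
  have hn' : coeffwise (-lam (M := L)) = -coeffwise (lam (M := L)) := by
    ext : 4; simp [coeffwise_single]
  have h1 : ∀ q, jacobiLeft B (transl L a) q = -coeffwise lam (jacobiLeft B a q) := by
    intro q
    simp only [jacobiLeft, hl, ← coeffwise_comp, hn', LinearMap.neg_apply]
  have h3 : ∀ q, jacobiLeft B b (-lam q) = -lam (jacobiLeft B b q) := by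
    intro q
    simp only [jacobiLeft, map_neg, lam_coeffwise]
  simp only [jacobiator, h1, jacobiRight_eq_swapVar, hB.sesq_left, h3, hn, jacobiMid_lam, map_neg,
    map_sub, map_add, swapVar_lam]
  abel

/-- Deduced from the first argument by applying skew-symmetry twice. -/
theorem IsSkewSesquilinear.jacobiator_transl_mid (hB : IsSkewSesquilinear B) (a b c : L) :
    jacobiator B a (transl L b) c = -lam (jacobiator B a b c) := by
  rw [hB.jacobiator_swap (transl L b) a c, hB.jacobiator_transl_left, map_neg, neg_neg,
    swapVar_coeffwise_lam, hB.jacobiator_swap a b c, map_neg, swapVar_swapVar, map_neg]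

theorem IsSkewSesquilinear.jacobiator_transl_right (hB : IsSkewSesquilinear B) (a b c : L) :
    jacobiator B a b (transl L c) =
      lamMuAdd L (jacobiator B a b c) := by
  have hr : ∀ a, B a ∘ₗ transl L = (lam + coeffwise (transl L)) ∘ₗ B a := by
    intro a; ext1 x; simp [hB.sesq_right, lamAdd]
  have h1 : ∀ a q, jacobiLeft B a (lamAdd (transl L) q) =
      lamMuAdd L (jacobiLeft B a q) := by
    intro a q
    simp only [jacobiLeft, lamAdd, LinearMap.add_apply, map_add, ← lam_coeffwise, coeffwise_comp,
      hr]
    rw [← coeffwise_comp, coeffwise_add]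
    simp only [LinearMap.add_apply, lamMuAdd]
    abel
  have hc : Commute (coeffwise (lam (M := L))) (lamMuAdd L) := by
    refine Commute.add_right (Commute.add_right (Commute.refl _) (commute_lam_coeffwise _)) ?_
    refine LinearMap.ext fun p => ?_
    simp only [Module.End.mul_apply, coeffwise_comp]
    congr 2
    exact LinearMap.ext fun p => lam_coeffwise _ p
  have h2 : ∀ q, jacobiMid B (transl L c) q =
      lamMuAdd L (jacobiMid B c q) := by
    intro q
    simp only [jacobiMid_eq, hB.bracketSum_transl_right, subst_comp_of_comm hc]
  have h3 : ∀ p : ℕ →₀ ℕ →₀ L, swapVar L (lamMuAdd L p) =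
      lamMuAdd L (swapVar L p) := by
    intro p
    simp only [lamMuAdd, LinearMap.add_apply, map_add, swapVar_lam,
      swapVar_coeffwise_lam, swapVar_coeffwise]
    abel
  simp only [jacobiator, jacobiRight_eq_swapVar, hB.sesq_right, h1, h2, h3, map_sub, map_add]

/-- The Jacobi identity holds if it holds on a `ℂ[∂]`-basis. -/
theorem IsSkewSesquilinear.isLieConformal_iff (hB : IsSkewSesquilinear B) {N : ℕ}
    (b : Module.Basis (Fin N) ℂ[X] L) :
    IsLieConformal B ↔ ∀ α β γ, jacobiator B (b α) (b β) (b γ) = 0 := by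
  refine ⟨fun h α β γ => jacobiator_eq_zero h _ _ _, fun h => hB.isLieConformal ?_⟩
  -- The basis vectors are replaced by arbitrary elements one argument at a time; each time the
  -- Jacobiator and the zero map intertwine `∂` with the same operator: `-λ`, then `-μ`, then `λ + μ
  -- + ∂`.
  have h1 : ∀ a β γ, jacobiator B a (b β) (b γ) = 0 := fun a β γ =>
    DFunLike.congr_fun (ext_of_transl b (f := (isLinearMap_jacobiator_left B (b β) (b γ)).mk' _)
      (g := 0) (-coeffwise lam) (fun a => by simp [hB.jacobiator_transl_left]) (by simp)
      (fun α => h α β γ)) a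
  have h2 : ∀ a a' γ, jacobiator B a a' (b γ) = 0 := fun a a' γ =>
    DFunLike.congr_fun (ext_of_transl b (f := (isLinearMap_jacobiator_mid B a (b γ)).mk' _)
      (g := 0) (-lam) (fun a' => by simp [hB.jacobiator_transl_mid]) (by simp)
      (fun β => h1 a β γ)) a'
  exact fun a a' c =>
    DFunLike.congr_fun (ext_of_transl b (f := (isLinearMap_jacobiator_right B a a').mk' _)
      (g := 0) (lamMuAdd L)
      (fun c => by simp [hB.jacobiator_transl_right]) (by simp) (fun γ => h2 a a' γ)) c

end Jacobiator

/-! ### Calculus in the algebra of functions on the arc space of `T*[1]𝔸ᴺ`. -/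

section HatRelations

variable {N : ℕ}

theorem hat_neg_mul (x y : HatAlg N) : -x * y = -(x * y) := neg_mul x y

theorem hat_mul_neg (x y : HatAlg N) : x * -y = -(x * y) := mul_neg x y

theorem hat_mul_sub (x y z : HatAlg N) : x * (y - z) = x * y - x * z := mul_sub x y z

theorem ofArc_mul_comm (p : ArcAlg N) (x : HatAlg N) : ofArc N p * x = x * ofArc N p := by
  induction x using TensorProduct.induction_on with
  | zero => simp
  | add x y hx hy => simp only [mul_add, add_mul, hx, hy]
  | tmul x q => simp [ofArc, mul_comm]

theorem ofArc_mul_tmul (p : ArcAlg N) (x : OddAlg N) (q : ArcAlg N) :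
    ofArc N p * (x ⊗ₜ q) = x ⊗ₜ (p * q) := by
  simp [ofArc]

theorem theta_mul_ofArc_mul (i : Fin N × ℕ) (p : ArcAlg N) (x : HatAlg N) :
    theta i * (ofArc N p * x) = ofArc N p * (theta i * x) := by
  rw [← mul_assoc, ← ofArc_mul_comm, mul_assoc]

theorem theta_mul_theta (i j : Fin N × ℕ) : theta i * theta j = -(theta j * theta i) := by
  rw [eq_neg_iff_add_eq_zero]
  simp only [theta, Algebra.TensorProduct.tmul_mul_tmul, ← TensorProduct.add_tmul, oddVar]
  rw [ExteriorAlgebra.ι_add_mul_swap, TensorProduct.zero_tmul]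

theorem theta_mul_theta_mul (i j : Fin N × ℕ) (x : HatAlg N) :
    theta i * (theta j * x) = -(theta j * (theta i * x)) := by
  rw [← mul_assoc, theta_mul_theta, hat_neg_mul, mul_assoc]

/-- An even element is central: moving it past an odd generator produces two signs, which cancel. -/
theorem commute_theta_mul_theta (i j : Fin N × ℕ) (x : HatAlg N) :
    Commute (theta i * theta j) x := by
  have h : ∀ y : OddAlg N, oddVar i * oddVar j * y = y * (oddVar i * oddVar j) := by
    intro y
    induction y using odd_induction with
    | algebraMap r => exact (Algebra.commutes r _).symm
    | add x y hx hy => simp only [mul_add, add_mul, hx, hy]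
    | ι_mul x v hx =>
      have h1 : ∀ i : Fin N × ℕ, oddVar i * ExteriorAlgebra.ι ℂ v =
          -(ExteriorAlgebra.ι ℂ v * oddVar i) := fun i =>
        eq_neg_iff_add_eq_zero.2 (ExteriorAlgebra.ι_add_mul_swap _ _)
      calc oddVar i * oddVar j * (ExteriorAlgebra.ι ℂ v * x)
          = oddVar i * (oddVar j * ExteriorAlgebra.ι ℂ v) * x := by simp only [mul_assoc]
        _ = -(oddVar i * ExteriorAlgebra.ι ℂ v * oddVar j * x) := by
            rw [h1]; simp only [mul_neg, neg_mul, mul_assoc]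
        _ = ExteriorAlgebra.ι ℂ v * (oddVar i * oddVar j * x) := by
            rw [h1]; simp only [neg_mul, neg_neg, mul_assoc]
        _ = _ := by rw [hx, mul_assoc]
  induction x using TensorProduct.induction_on with
  | zero => exact Commute.zero_right _
  | add x y hx hy => exact hx.add_right hy
  | tmul x q =>
    simp only [theta, Algebra.TensorProduct.tmul_mul_tmul, Commute, SemiconjBy, h, mul_one, one_mul]

theorem hatDer_ofArc (p : ArcAlg N) : hatDer N (ofArc N p) = ofArc N (arcDer N p) := by
  have h : oddDer N 1 = 0 := by simpa using oddDer_algebraMap (N := N) 1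
  simp [ofArc, hatDer_tmul, h]

theorem hatDer_theta (α : Fin N) (n : ℕ) : hatDer N (theta (α, n)) = theta (α, n + 1) := by
  simp [theta, hatDer_tmul, oddVar, oddDer_ι, oddShift]

theorem hatDer_pow_theta (α : Fin N) (n : ℕ) : (hatDer N ^ n) (theta (α, 0)) = theta (α, n) := by
  induction n with
  | zero => simp
  | succ n ih => rw [pow_succ', Module.End.mul_apply, ih, hatDer_theta]

theorem dTheta_ofArc_mul (i : Fin N × ℕ) (p : ArcAlg N) (x : HatAlg N) :
    dTheta i (ofArc N p * x) = ofArc N p * dTheta i x := by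
  induction x using TensorProduct.induction_on with
  | zero => simp
  | add x y hx hy => simp only [mul_add, map_add, hx, hy]
  | tmul x q => simp [ofArc_mul_tmul, dTheta_tmul]

theorem dTheta_one (i : Fin N × ℕ) : dTheta i (1 : HatAlg N) = 0 := by
  have h : dOdd i (1 : OddAlg N) = 0 := by simpa using dOdd_algebraMap i 1
  rw [Algebra.TensorProduct.one_def, dTheta_tmul, h, TensorProduct.zero_tmul]

theorem dTheta_theta_mul (i j : Fin N × ℕ) (x : HatAlg N) :
    dTheta i (theta j * x) = (if j = i then x else 0) - theta j * dTheta i x := by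
  classical
  induction x using TensorProduct.induction_on with
  | zero => simp
  | add x y hx hy =>
    simp only [mul_add, map_add, hx, hy]
    split_ifs <;> abel
  | tmul x q =>
    simp only [theta, Algebra.TensorProduct.tmul_mul_tmul, dTheta_tmul, oddVar, dOdd_ι_mul,
      TensorProduct.sub_tmul, one_mul, Finsupp.single_apply]
    split_ifs <;> simp

theorem dTheta_theta (i j : Fin N × ℕ) :
    dTheta i (theta j) = if j = i then 1 else 0 := by
  simpa [dTheta_one] using dTheta_theta_mul i j 1

theorem dU_mul (i : Fin N × ℕ) (x y : HatAlg N) : dU i (x * y) = x * dU i y + dU i x * y := by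
  induction x using TensorProduct.induction_on with
  | zero => simp
  | add x x' hx hx' => simp only [add_mul, map_add, hx, hx']; abel
  | tmul x p =>
    induction y using TensorProduct.induction_on with
    | zero => simp
    | add y y' hy hy' => simp only [mul_add, map_add, hy, hy']; abel
    | tmul y q =>
      simp only [Algebra.TensorProduct.tmul_mul_tmul, dU_tmul, Derivation.leibniz,
        TensorProduct.tmul_add, smul_eq_mul, mul_comm q]

theorem dU_theta (i j : Fin N × ℕ) : dU i (theta j) = 0 := by
  simp [theta, dU_tmul]

theorem dU_ofArc (i : Fin N × ℕ) (p : ArcAlg N) :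
    dU i (ofArc N p) = ofArc N (MvPolynomial.pderiv i p) := by
  simp [ofArc, dU_tmul]

theorem parity_theta_mul_theta_mul (i j : Fin N × ℕ) (p : ArcAlg N) :
    parity N (ofArc N p * (theta i * theta j)) = ofArc N p * (theta i * theta j) := by
  have h : ∀ w : (Fin N × ℕ) →₀ ℂ, CliffordAlgebra.involute (ExteriorAlgebra.ι ℂ w) =
      -ExteriorAlgebra.ι ℂ w := fun w => CliffordAlgebra.involute_ι w
  simp [theta, ofArc, parity, oddVar, h]

theorem theta_mul_theta_mem_hatDeg (i j : Fin N × ℕ) (p : ArcAlg N) :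
    ofArc N p * (theta i * theta j) ∈ hatDeg N 2 := by
  have h : oddVar i * oddVar j ∈ ⋀[ℂ]^2 ((Fin N × ℕ) →₀ ℂ) := by
    rw [ExteriorAlgebra.exteriorPower, pow_two]
    exact Submodule.mul_mem_mul (LinearMap.mem_range_self _ _) (LinearMap.mem_range_self _ _)
  refine ⟨⟨_, h⟩ ⊗ₜ p, ?_⟩
  simp [theta, ofArc]

theorem gradTheta_apply (σ : Fin N) (f : HatAlg N) (n : ℕ) :
    gradTheta σ f n = dTheta (σ, n) f := by
  simp [gradTheta, Finsupp.ofSupportFinite_coe]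

theorem gradU_apply (σ : Fin N) (f : HatAlg N) (n : ℕ) : gradU σ f n = dU (σ, n) f := by
  simp [gradU, Finsupp.ofSupportFinite_coe]

theorem coeffwise_apply {M M' : Type*} [AddCommGroup M] [Module ℂ M] [AddCommGroup M']
    [Module ℂ M'] (f : M →ₗ[ℂ] M') (p : ℕ →₀ M) (n : ℕ) : coeffwise f p n = f (p n) := by
  simp [coeffwise]

theorem gradTheta_ofArc_mul (σ : Fin N) (p : ArcAlg N) (x : HatAlg N) :
    gradTheta σ (ofArc N p * x) = coeffwise (LinearMap.mulLeft ℂ (ofArc N p)) (gradTheta σ x) := by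
  ext1 n
  simp [gradTheta_apply, coeffwise_apply, dTheta_ofArc_mul]

theorem gradTheta_theta_mul (σ : Fin N) (i : Fin N × ℕ) (x : HatAlg N) :
    gradTheta σ (theta i * x) = (if i.1 = σ then Finsupp.single i.2 x else 0) +
      coeffwise (LinearMap.mulLeft ℂ (-theta i)) (gradTheta σ x) := by
  classical
  ext1 n
  obtain ⟨α, k⟩ := i
  simp only [gradTheta_apply, coeffwise_apply, dTheta_theta_mul, Finsupp.add_apply,
    LinearMap.mulLeft_apply, Prod.mk.injEq, hat_neg_mul, sub_eq_add_neg]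
  split_ifs <;> simp_all

theorem gradTheta_theta (σ : Fin N) (i : Fin N × ℕ) :
    gradTheta σ (theta i) = if i.1 = σ then Finsupp.single i.2 1 else 0 := by
  have h : gradTheta σ (1 : HatAlg N) = 0 := by
    ext1 n
    simp [gradTheta_apply, dTheta_one]
  simpa [h] using gradTheta_theta_mul σ i 1

theorem gradU_mul_of_dU_eq_zero (σ : Fin N) (f g : HatAlg N) (h : ∀ i, dU i g = 0) :
    gradU σ (f * g) = coeffwise (LinearMap.mulRight ℂ g) (gradU σ f) := by
  ext1 n
  simp [gradU_apply, coeffwise_apply, dU_mul, h]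

theorem gradU_ofArc_X_zero (σ α : Fin N) :
    gradU σ (ofArc N (MvPolynomial.X (α, 0))) = if α = σ then Finsupp.single 0 1 else 0 := by
  classical
  ext1 n
  simp only [gradU_apply, dU_ofArc, MvPolynomial.pderiv_X]
  split_ifs with h
  · subst h
    cases n <;> simp
  · have : (α, 0) ≠ (σ, n) := fun e => h (by simp_all)
    simp [this]

end HatRelations

/-! ### Variational derivatives, integration by parts and the Euler operator. -/

section Variational

variable {N : ℕ}

/-- At `λ = 0` the substitution `-λ-∂` is `-∂`; this is how variational derivatives arise from the
λ-bracket. -/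
theorem negLamSub_apply_zero {M : Type*} [AddCommGroup M] [Module ℂ M] (d : M →ₗ[ℂ] M)
    (p : ℕ →₀ M) : negLamSub d p 0 = subst (-d) LinearMap.id p := by
  have h : ∀ (n : ℕ) (q : ℕ →₀ M), (((-lamAdd d) ^ n) q) 0 = ((-d) ^ n) (q 0) := by
    intro n q
    induction n with
    | zero => simp
    | succ n ih =>
      rw [pow_succ', pow_succ', Module.End.mul_apply, Module.End.mul_apply, ← ih]
      simp [lamAdd, lam_zero, coeffwise_apply]
  induction p using Finsupp.induction_linear with
  | zero => simp
  | add p q hp hq => simp only [map_add, Finsupp.add_apply, hp, hq]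
  | single n m => simp [negLamSub, subst_single, h]

/-- The variational derivative `∑ₙ (-∂) ^ n ∂f/∂θ_σ^{(n)}`. -/
def varTheta (σ : Fin N) : HatAlg N →ₗ[ℂ] HatAlg N :=
  subst (-hatDer N) LinearMap.id ∘ₗ gradTheta σ

/-- The variational derivative `∑ₙ (-∂) ^ n ∂f/∂u^{σ,(n)}`. -/
def varU (σ : Fin N) : HatAlg N →ₗ[ℂ] HatAlg N :=
  subst (-hatDer N) LinearMap.id ∘ₗ gradU σ

/-- The gradient of `∂f` has a factor `λ + ∂`, which the substitution turns into `-λ`, and this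
vanishes at `λ = 0`. -/
theorem varTheta_hatDer (σ : Fin N) (f : HatAlg N) : varTheta σ (hatDer N f) = 0 := by
  simp only [varTheta, LinearMap.comp_apply, gradTheta_hatDer, ← negLamSub_apply_zero,
    negLamSub_lamAdd, Finsupp.neg_apply, lam_zero, neg_zero]

/-- `∑ λ ^ n hₙ ↦ ∑ (∂ ^ n x) hₙ`. -/
def jetMul (x : HatAlg N) : (ℕ →₀ HatAlg N) →ₗ[ℂ] HatAlg N :=
  Finsupp.lsum ℂ fun n => LinearMap.mulLeft ℂ ((hatDer N ^ n) x)

theorem jetMul_single (x : HatAlg N) (n : ℕ) (h : HatAlg N) :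
    jetMul x (Finsupp.single n h) = (hatDer N ^ n) x * h := by
  simp [jetMul]

theorem jetMul_lamAdd (x : HatAlg N) (q : ℕ →₀ HatAlg N) :
    jetMul x (lamAdd (hatDer N) q) = hatDer N (jetMul x q) := by
  induction q using Finsupp.induction_linear with
  | zero => simp
  | add p q hp hq => simp only [map_add, hp, hq]
  | single n m =>
    simp only [lamAdd, LinearMap.add_apply, lam_single, coeffwise_single, map_add, jetMul_single,
      hatDer_mul, pow_succ', Module.End.mul_apply]
    abel

theorem integral_hatDer (f : HatAlg N) : integral N (hatDer N f) = 0 :=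
  (Submodule.Quotient.mk_eq_zero _).2 ⟨f, rfl⟩

theorem integral_hatDer_mul (f g : HatAlg N) :
    integral N (hatDer N f * g) = -integral N (f * hatDer N g) := by
  rw [eq_neg_iff_add_eq_zero, ← map_add, add_comm, ← hatDer_mul, integral_hatDer]

theorem integral_hatDer_pow_mul (n : ℕ) (f g : HatAlg N) :
    integral N ((hatDer N ^ n) f * g) = integral N (f * ((-hatDer N) ^ n) g) := by
  induction n generalizing f with
  | zero => simp
  | succ n ih =>
    rw [pow_succ, pow_succ', Module.End.mul_apply, Module.End.mul_apply, ih, integral_hatDer_mul,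
      LinearMap.neg_apply, hat_mul_neg, map_neg]

/-- Repeated integration by parts. -/
theorem integral_mul_subst (x : HatAlg N) (q : ℕ →₀ HatAlg N) :
    integral N (x * subst (-hatDer N) LinearMap.id q) = integral N (jetMul x q) := by
  induction q using Finsupp.induction_linear with
  | zero => simp
  | add p q hp hq => simp only [map_add, mul_add, hp, hq]
  | single n m => simp [subst_single, jetMul_single, integral_hatDer_pow_mul]

theorem actOn_apply_zero (w q : ℕ →₀ HatAlg N) : actOn (hatDer N) w q 0 = jetMul (w 0) q := by
  have h : ∀ (n : ℕ) (q : ℕ →₀ HatAlg N),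
      ((lamAdd (hatDer N) ^ n) q) 0 = (hatDer N ^ n) (q 0) := by
    intro n q
    induction n with
    | zero => simp
    | succ n ih =>
      rw [pow_succ', pow_succ', Module.End.mul_apply, Module.End.mul_apply, ← ih]
      simp [lamAdd, lam_zero, coeffwise_apply]
  induction q using Finsupp.induction_linear with
  | zero => simp
  | add p q hp hq => simp only [map_add, Finsupp.add_apply, hp, hq]
  | single n m => simp [actOn_single, jetMul_single, coeffwise_apply, h]

/-- The parity hypothesis removes the sign `(-1)^{|f|}`; integration by parts then moves the
derivatives onto the gradients of `g`. -/
theorem functionalBracket_eq (f g : HatAlg N) (hf : parity N f = f) :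
    functionalBracket N (integral N f) (integral N g) =
      integral N (∑ σ, (varTheta σ f * varU σ g + varU σ f * varTheta σ g)) := by
  rw [functionalBracket_integral, chiralBracket_apply, Finsupp.finsetSum_apply, map_sum, map_sum]
  refine Finset.sum_congr rfl fun σ _ => ?_
  simp only [Finsupp.add_apply, actOn_apply_zero, bracketWithU, bracketWithTheta,
    LinearMap.comp_apply, hf, negLamSub_apply_zero, map_add, varTheta, varU, integral_mul_subst]

/-- Differentiating `f g = g f` by an even derivation and cancelling shows that the derivative of a
central element is central. -/
theorem commute_varU {f : HatAlg N} (hf : ∀ g, Commute f g) (σ : Fin N) (g : HatAlg N) :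
    Commute (varU σ f) g := by
  have hU : ∀ i g, Commute (dU i f) g := by
    intro i g
    have h := congrArg (dU i) (hf g).eq
    rw [dU_mul, dU_mul, (hf (dU i g)).eq, add_comm] at h
    exact add_right_cancel h
  have hd : ∀ x : HatAlg N, (∀ g, Commute x g) → ∀ g, Commute (hatDer N x) g := by
    intro x hx g
    have h := congrArg (hatDer N) (hx g).eq
    rw [hatDer_mul, hatDer_mul, (hx (hatDer N g)).eq, add_comm] at h
    exact add_right_cancel h
  have hp : ∀ (n : ℕ) (x : HatAlg N), (∀ g, Commute x g) →
      ∀ g, Commute (((-hatDer N) ^ n) x) g := by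
    intro n
    induction n with
    | zero => intro x hx g; simpa using hx g
    | succ n ih =>
      intro x hx g
      rw [pow_succ, Module.End.mul_apply]
      exact ih _ (fun g => (hd x hx g).neg_left) g
  simp only [varU, LinearMap.comp_apply, subst, Finsupp.lsum_apply, Finsupp.sum]
  exact Commute.sum_left _ _ _ fun n _ => hp n _ (by simpa [gradU_apply] using hU (σ, n)) g

theorem functionalBracket_comm {f g : HatAlg N} (hf : parity N f = f) (hg : parity N g = g)
    (hf' : ∀ x, Commute f x) (hg' : ∀ x, Commute g x) :
    functionalBracket N (integral N f) (integral N g) =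
      functionalBracket N (integral N g) (integral N f) := by
  rw [functionalBracket_eq f g hf, functionalBracket_eq g f hg]
  congr 1
  refine Finset.sum_congr rfl fun σ _ => ?_
  rw [(commute_varU hf' σ _).eq, (commute_varU hg' σ _).eq, add_comm]

/-- For central even `f` the two products in the bracket coincide, whence the 2. Integrating back by
parts displays the result as the evolutionary vector field with components `δf/δθ_σ` applied to `f`.
-/
theorem functionalBracket_self {f : HatAlg N} (hf : parity N f = f) (hf' : ∀ x, Commute f x) :
    functionalBracket N (integral N f) (integral N f) =
      (2 : ℂ) • integral N (∑ σ, jetMul (varTheta σ f) (gradU σ f)) := by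
  rw [functionalBracket_eq f f hf, map_sum, map_sum, Finset.smul_sum]
  refine Finset.sum_congr rfl fun σ _ => ?_
  rw [(commute_varU hf' σ _).eq, ← two_smul ℂ, map_smul, ← integral_mul_subst]
  rfl

/-- The Euler operator `∑ θ_σ^{(n)} ∂/∂θ_σ^{(n)}`. -/
def euler (N : ℕ) : HatAlg N →ₗ[ℂ] HatAlg N := ∑ σ, jetMul (theta (σ, 0)) ∘ₗ gradTheta σ

theorem integral_euler (f : HatAlg N) :
    integral N (euler N f) = integral N (∑ σ, theta (σ, 0) * varTheta σ f) := by
  simp [euler, LinearMap.sum_apply, varTheta, integral_mul_subst]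

/-- The Euler operator is an even derivation: the sign from the odd derivative passing `θ_i` cancels
the one from exchanging `θ_i` with the jet of `θ_σ`. -/
theorem euler_theta_mul (i : Fin N × ℕ) (x : HatAlg N) :
    euler N (theta i * x) = theta i * x + theta i * euler N x := by
  classical
  have h : ∀ (σ : Fin N) (q : ℕ →₀ HatAlg N),
      jetMul (theta (σ, 0)) (coeffwise (LinearMap.mulLeft ℂ (-theta i)) q) =
        theta i * jetMul (theta (σ, 0)) q := by
    intro σ q
    induction q using Finsupp.induction_linear with
    | zero => simp
    | add p q hp hq => simp only [map_add, mul_add, hp, hq]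
    | single n m =>
      simp only [coeffwise_single, jetMul_single, hatDer_pow_theta, LinearMap.mulLeft_apply,
        hat_neg_mul, hat_mul_neg]
      rw [theta_mul_theta_mul, neg_neg]
  simp only [euler, LinearMap.sum_apply, LinearMap.comp_apply, gradTheta_theta_mul, map_add, h,
    Finset.sum_add_distrib, Finset.mul_sum]
  congr 1
  rw [Finset.sum_eq_single i.1]
  · simp [jetMul_single, hatDer_pow_theta]
  · intro σ _ hσ
    simp [hσ.symm]
  · simp

theorem euler_ofArc_mul (p : ArcAlg N) (x : HatAlg N) :
    euler N (ofArc N p * x) = ofArc N p * euler N x := by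
  have h : ∀ (σ : Fin N) (q : ℕ →₀ HatAlg N),
      jetMul (theta (σ, 0)) (coeffwise (LinearMap.mulLeft ℂ (ofArc N p)) q) =
        ofArc N p * jetMul (theta (σ, 0)) q := by
    intro σ q
    induction q using Finsupp.induction_linear with
    | zero => simp
    | add p q hp hq => simp only [map_add, mul_add, hp, hq]
    | single n m =>
      simp only [coeffwise_single, jetMul_single, hatDer_pow_theta, LinearMap.mulLeft_apply]
      exact theta_mul_ofArc_mul _ _ _
  simp only [euler, LinearMap.sum_apply, LinearMap.comp_apply, gradTheta_ofArc_mul, h,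
    Finset.mul_sum]

theorem euler_cubic (p : ArcAlg N) (i j k : Fin N × ℕ) :
    euler N (ofArc N p * (theta i * (theta j * theta k))) =
      (3 : ℂ) • (ofArc N p * (theta i * (theta j * theta k))) := by
  have h1 : euler N (1 : HatAlg N) = 0 := by
    have : ∀ σ : Fin N, gradTheta σ (1 : HatAlg N) = 0 := by
      intro σ
      ext1 n
      simp [gradTheta_apply, dTheta_one]
    simp [euler, LinearMap.sum_apply, this]
  have h2 : euler N (theta k) = theta k := by simpa [h1] using euler_theta_mul k 1
  simp only [euler_ofArc_mul, euler_theta_mul, h2, mul_add]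
  module

end Variational

/-! ### The bivector, its bracket with itself, and the Jacobiator. -/

section Cubic

variable {L : Type*} [AddCommGroup L] [Module ℂ L] {N : ℕ}

/-- `∑ λ ^ n cₙ ↦ ∑ j(cₙ) ∂ ^ n G`. -/
def applyTo (j : L →ₗ[ℂ] HatAlg N) (G : HatAlg N) : (ℕ →₀ L) →ₗ[ℂ] HatAlg N :=
  Finsupp.lsum ℂ fun n => LinearMap.mulRight ℂ ((hatDer N ^ n) G) ∘ₗ j

theorem applyTo_single (j : L →ₗ[ℂ] HatAlg N) (G : HatAlg N) (n : ℕ) (x : L) :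
    applyTo j G (Finsupp.single n x) = j x * (hatDer N ^ n) G := by
  simp [applyTo]

/-- The adjoint action `∑ λ ^ n cₙ ↦ ∑ (-∂) ^ n (j(cₙ) G)`. -/
def adjointTo (j : L →ₗ[ℂ] HatAlg N) (G : HatAlg N) : (ℕ →₀ L) →ₗ[ℂ] HatAlg N :=
  subst (-hatDer N) (LinearMap.mulRight ℂ G ∘ₗ j)

theorem adjointTo_single (j : L →ₗ[ℂ] HatAlg N) (G : HatAlg N) (n : ℕ) (x : L) :
    adjointTo j G (Finsupp.single n x) = ((-hatDer N) ^ n) (j x * G) := by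
  simp [adjointTo, subst_single]

/-- `∑ λ ^ n μ ^ m c ↦ ∑ j(c) (∂ ^ n G) (∂ ^ m H)`. -/
def applyTo₂ (j : L →ₗ[ℂ] HatAlg N) (G H : HatAlg N) : (ℕ →₀ ℕ →₀ L) →ₗ[ℂ] HatAlg N :=
  Finsupp.lsum ℂ fun m => LinearMap.mulRight ℂ ((hatDer N ^ m) H) ∘ₗ applyTo j G

theorem applyTo₂_single (j : L →ₗ[ℂ] HatAlg N) (G H : HatAlg N) (m : ℕ) (p : ℕ →₀ L) :
    applyTo₂ j G H (Finsupp.single m p) = applyTo j G p * (hatDer N ^ m) H := by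
  simp [applyTo₂]

theorem applyTo₂_lam (j : L →ₗ[ℂ] HatAlg N) (G H : HatAlg N) (p : ℕ →₀ ℕ →₀ L) :
    applyTo₂ j G H (lam p) = applyTo₂ j G (hatDer N H) p := by
  induction p using Finsupp.induction_linear with
  | zero => simp
  | add p q hp hq => simp only [map_add, hp, hq]
  | single m p => simp [lam_single, applyTo₂_single, pow_succ]

theorem applyTo_lam (j : L →ₗ[ℂ] HatAlg N) (G : HatAlg N) (p : ℕ →₀ L) :
    applyTo j G (lam p) = applyTo j (hatDer N G) p := by
  induction p using Finsupp.induction_linear with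
  | zero => simp
  | add p q hp hq => simp only [map_add, hp, hq]
  | single m p => simp [lam_single, applyTo_single, pow_succ]

theorem applyTo₂_coeffwise_lam (j : L →ₗ[ℂ] HatAlg N) (G H : HatAlg N) (p : ℕ →₀ ℕ →₀ L) :
    applyTo₂ j G H (coeffwise lam p) = applyTo₂ j (hatDer N G) H p := by
  induction p using Finsupp.induction_linear with
  | zero => simp
  | add p q hp hq => simp only [map_add, hp, hq]
  | single m p => simp [coeffwise_single, applyTo₂_single, applyTo_lam]

theorem applyTo₂_coeffwise_lam_pow (j : L →ₗ[ℂ] HatAlg N) (G H : HatAlg N) (n : ℕ)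
    (p : ℕ →₀ ℕ →₀ L) :
    applyTo₂ j G H ((coeffwise lam ^ n) p) = applyTo₂ j ((hatDer N ^ n) G) H p := by
  induction n generalizing p with
  | zero => simp
  | succ n ih =>
    rw [pow_succ, pow_succ', Module.End.mul_apply, Module.End.mul_apply, ih,
      applyTo₂_coeffwise_lam]

/-- With `λ` acting as `∂` on `G` and `μ` as `∂` on `H`, the Leibniz rule makes `λ + μ` act as `∂`
on `G * H`. -/
theorem applyTo₂_sum_pow (j : L →ₗ[ℂ] HatAlg N) (G H : HatAlg N) (n : ℕ) (x : L) :
    applyTo₂ j G H (((coeffwise (lam (M := L)) + lam (M := ℕ →₀ L)) ^ n)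
      (Finsupp.single 0 (Finsupp.single 0 x))) =
      j x * (hatDer N ^ n) (G * H) := by
  induction n generalizing G H with
  | zero => simp [applyTo₂_single, applyTo_single, mul_assoc]
  | succ n ih =>
    rw [pow_succ', Module.End.mul_apply, LinearMap.add_apply, map_add, applyTo₂_coeffwise_lam,
      applyTo₂_lam, ih, ih, pow_succ, Module.End.mul_apply, hatDer_mul, map_add, mul_add, add_comm]

theorem applyTo₂_bracketSum (B : L →ₗ[ℂ] L →ₗ[ℂ] (ℕ →₀ L)) (j : L →ₗ[ℂ] HatAlg N)
    (G H : HatAlg N) (x c : L) :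
    applyTo₂ j G H (bracketSum B c x) = applyTo j (G * H) (B x c) := by
  simp only [bracketSum, LinearMap.comp_apply, LinearMap.flip_apply]
  induction B x c using Finsupp.induction_linear with
  | zero => simp
  | add p q hp hq => simp only [map_add, hp, hq]
  | single n y =>
    rw [subst_single, applyTo_single, ← applyTo₂_sum_pow]
    rfl

theorem applyTo₂_jacobiMid_single (B : L →ₗ[ℂ] L →ₗ[ℂ] (ℕ →₀ L)) (j : L →ₗ[ℂ] HatAlg N)
    (G H : HatAlg N) (n : ℕ) (x c : L) :
    applyTo₂ j G H (jacobiMid B c (Finsupp.single n x)) =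
      applyTo j ((hatDer N ^ n) G * H) (B x c) := by
  rw [jacobiMid_eq, subst_single, applyTo₂_coeffwise_lam_pow, applyTo₂_bracketSum]

variable [Module ℂ[X] L] [IsScalarTower ℂ ℂ[X] L]

section

variable {j : L →ₗ[ℂ] HatAlg N}

theorem applyTo_lamAdd (hj : ∀ x, j (transl L x) = hatDer N (j x)) (G : HatAlg N) (p : ℕ →₀ L) :
    applyTo j G (lamAdd (transl L) p) = hatDer N (applyTo j G p) := by
  induction p using Finsupp.induction_linear with
  | zero => simp
  | add p q hp hq => simp only [map_add, hp, hq]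
  | single n x =>
    simp only [lamAdd, LinearMap.add_apply, lam_single, coeffwise_single, map_add, applyTo_single,
      hatDer_mul, pow_succ', Module.End.mul_apply, hj]

theorem applyTo_negLamSub (hj : ∀ x, j (transl L x) = hatDer N (j x)) (G : HatAlg N) (p : ℕ →₀ L) :
    applyTo j G (negLamSub (transl L) p) = adjointTo j G p := by
  have h : ∀ (n : ℕ) (q : ℕ →₀ L), applyTo j G (((-lamAdd (transl L)) ^ n) q) =
      ((-hatDer N) ^ n) (applyTo j G q) := by
    intro n q
    induction n with
    | zero => simp
    | succ n ih =>
      rw [pow_succ', pow_succ', Module.End.mul_apply, Module.End.mul_apply, ← ih,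
        LinearMap.neg_apply, LinearMap.neg_apply, map_neg, applyTo_lamAdd hj]
  induction p using Finsupp.induction_linear with
  | zero => simp
  | add p q hp hq => simp only [map_add, hp, hq]
  | single n x => simp [negLamSub, subst_single, h, adjointTo_single, applyTo_single]

/-- Skewness of the λ-bracket read as skew-adjointness of differential operators. The map `j` is
kept general because both `hatEmb` and `hamiltonian` are needed. -/
theorem IsSkewSesquilinear.adjointTo_eq {B : L →ₗ[ℂ] L →ₗ[ℂ] (ℕ →₀ L)}
    (hB : IsSkewSesquilinear B) (hj : ∀ x, j (transl L x) = hatDer N (j x)) (G : HatAlg N)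
    (a c : L) : adjointTo j G (B a c) = -applyTo j G (B c a) := by
  rw [hB.skew a c, map_neg, applyTo_negLamSub hj, neg_neg]

end

variable (b : Module.Basis (Fin N) ℂ[X] L)

/-- The embedding `∂ ^ n b_α ↦ u^{α,(n)}` of `L` in the functions on the arc space of
`T*[1]𝔸ᴺ`. -/
def hatEmb : L →ₗ[ℂ] HatAlg N := (ofArc N).toLinearMap ∘ₗ jetEmb b

theorem hatEmb_apply (x : L) : hatEmb b x = ofArc N (jetEmb b x) := rfl

theorem hatEmb_transl (x : L) : hatEmb b (transl L x) = hatDer N (hatEmb b x) := by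
  simp [hatEmb_apply, jetEmb_transl, hatDer_ofArc]

theorem hatEmb_injective : Function.Injective (hatEmb b) := by
  have h : Function.Injective (ofArc N) :=
    Algebra.TensorProduct.includeRight_injective
      (ExteriorAlgebra.algebraMap_leftInverse _).injective
  exact h.comp (jetEmb_injective b)

variable (B : L →ₗ[ℂ] L →ₗ[ℂ] (ℕ →₀ L))

/-- `x ↦ ∑ {u^γ_∂ x}_→ θ_γ`, the Hamiltonian vector field of `P` up to a factor. -/
def hamiltonian : L →ₗ[ℂ] HatAlg N := ∑ γ, applyTo (hatEmb b) (theta (γ, 0)) ∘ₗ B (b γ)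

theorem hamiltonian_apply (x : L) :
    hamiltonian b B x = ∑ γ, applyTo (hatEmb b) (theta (γ, 0)) (B (b γ) x) := by
  simp [hamiltonian, LinearMap.sum_apply]

theorem bivector_eq : bivector B b =
    ∑ α, ∑ β, theta (α, 0) * applyTo (hatEmb b) (theta (β, 0)) (B (b β) (b α)) := by
  unfold bivector
  refine Finset.sum_congr rfl fun α _ => Finset.sum_congr rfl fun β _ => ?_
  rw [pvaBracket_X_zero]
  congr 1
  rw [coeffwise, Finsupp.mapRange.linearMap_apply, Finsupp.sum_mapRange_index (by simp)]
  simp only [applyTo, Finsupp.lsum_apply, hatDer_pow_theta]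
  rfl

/-- The quadratic functions are spanned by the `p θ_i θ_j`; a subspace which contains these contains
the bivector. -/
theorem bivector_mem (S : Submodule ℂ (HatAlg N))
    (h : ∀ p i j, ofArc N p * (theta i * theta j) ∈ S) : bivector B b ∈ S := by
  rw [bivector_eq]
  refine Submodule.sum_mem _ fun α _ => Submodule.sum_mem _ fun β _ => ?_
  induction B (b β) (b α) using Finsupp.induction_linear with
  | zero => simp
  | add p q hp hq => simp only [map_add, mul_add]; exact S.add_mem hp hq
  | single n x =>
    rw [applyTo_single, hatDer_pow_theta, hatEmb_apply, theta_mul_ofArc_mul]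
    exact h _ _ _

theorem bivector_mem_hatDeg : bivector B b ∈ hatDeg N 2 :=
  bivector_mem b B _ fun p i j => theta_mul_theta_mem_hatDeg i j p

theorem parity_bivector : parity N (bivector B b) = bivector B b := by
  have := bivector_mem b B (LinearMap.eqLocus (parity N) LinearMap.id)
    fun p i j => parity_theta_mul_theta_mul i j p
  exact this

theorem commute_bivector (x : HatAlg N) : Commute (bivector B b) x := by
  have := bivector_mem b B
    (LinearMap.eqLocus (LinearMap.mulRight ℂ x) (LinearMap.mulLeft ℂ x)) fun p i j =>
      ((show Commute (ofArc N p) x from ofArc_mul_comm p x).mul_left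
        (commute_theta_mul_theta i j x))
  exact this

variable {B}

theorem IsSkewSesquilinear.hamiltonian_transl (hB : IsSkewSesquilinear B) (x : L) :
    hamiltonian b B (transl L x) = hatDer N (hamiltonian b B x) := by
  simp only [hamiltonian_apply, hB.sesq_right, applyTo_lamAdd (hatEmb_transl b), map_sum]

/-- One term for each odd factor: the second has a sign from passing `θ_α` and is the adjoint
because `θ_β` carries derivatives. -/
theorem varTheta_theta_mul_applyTo (σ α β : Fin N) (p : ℕ →₀ L) :
    varTheta σ (theta (α, 0) * applyTo (hatEmb b) (theta (β, 0)) p) =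
      (if α = σ then applyTo (hatEmb b) (theta (β, 0)) p else 0) -
        (if β = σ then adjointTo (hatEmb b) (theta (α, 0)) p else 0) := by
  induction p using Finsupp.induction_linear with
  | zero => simp
  | add p q hp hq =>
    simp only [map_add, mul_add, hp, hq]
    split_ifs <;> abel
  | single n x =>
    simp only [applyTo_single, adjointTo_single, hatDer_pow_theta, hatEmb_apply, varTheta,
      LinearMap.comp_apply, theta_mul_ofArc_mul, gradTheta_ofArc_mul, gradTheta_theta_mul,
      gradTheta_theta]
    split_ifs <;> simp [coeffwise_single, subst_single, sub_eq_add_neg, -Finsupp.single_mul]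

/-- The two odd factors of `P` contribute equally by skew-adjointness. -/
theorem IsSkewSesquilinear.varTheta_bivector (hB : IsSkewSesquilinear B) (σ : Fin N) :
    varTheta σ (bivector B b) = (2 : ℂ) • hamiltonian b B (b σ) := by
  classical
  rw [bivector_eq]
  simp only [map_sum, varTheta_theta_mul_applyTo, Finset.sum_sub_distrib]
  rw [Finset.sum_comm]
  simp only [Finset.sum_ite_eq', Finset.mem_univ, if_true, hB.adjointTo_eq (hatEmb_transl b),
    Finset.sum_neg_distrib, sub_neg_eq_add, two_smul, hamiltonian_apply]

/-- Both sides intertwine `∂`, so the formula on linear functions follows from `varTheta_bivector`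
on the basis. -/
theorem IsSkewSesquilinear.jetMul_hatEmb (hB : IsSkewSesquilinear B) (x : L) :
    ∑ σ, jetMul (varTheta σ (bivector B b)) (gradU σ (hatEmb b x)) =
      (2 : ℂ) • hamiltonian b B x := by
  classical
  have := ext_of_transl b (f := ∑ σ, jetMul (varTheta σ (bivector B b)) ∘ₗ gradU σ ∘ₗ hatEmb b)
    (g := (2 : ℂ) • hamiltonian b B) (hatDer N) (fun a => ?_) (fun a => ?_) (fun α => ?_)
  · simpa [LinearMap.sum_apply] using DFunLike.congr_fun this x
  · simp [LinearMap.sum_apply, hatEmb_transl, gradU_hatDer, jetMul_lamAdd]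
  · simp [hB.hamiltonian_transl]
  · simp only [LinearMap.sum_apply, LinearMap.comp_apply, hatEmb_apply, jetEmb_basis,
      gradU_ofArc_X_zero, LinearMap.smul_apply, ← hB.varTheta_bivector]
    rw [Finset.sum_eq_single α]
    · simp [jetMul_single]
    · intro σ _ hσ
      simp [hσ.symm]
    · simp

variable (B) in
/-- The cubic function `∑ {u^γ_∂ {u^β_∂ u^α}} θ_γ θ_β θ_α`. -/
def trivector : HatAlg N :=
  ∑ α, ∑ β, applyTo (hamiltonian b B) (theta (β, 0)) (B (b β) (b α)) * theta (α, 0)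

theorem jetMul_coeffwise_mulRight (x g : HatAlg N) (q : ℕ →₀ HatAlg N) :
    jetMul x (coeffwise (LinearMap.mulRight ℂ g) q) = jetMul x q * g := by
  induction q using Finsupp.induction_linear with
  | zero => simp
  | add p q hp hq => simp only [map_add, add_mul, hp, hq]
  | single n m => simp [coeffwise_single, jetMul_single, mul_assoc, -Finsupp.single_mul]

theorem IsSkewSesquilinear.functionalBracket_bivector (hB : IsSkewSesquilinear B) :
    functionalBracket N (integral N (bivector B b)) (integral N (bivector B b)) =
      (-4 : ℂ) • integral N (trivector b B) := by
  rw [functionalBracket_self (parity_bivector b B) (commute_bivector b B)]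
  set V : HatAlg N →ₗ[ℂ] HatAlg N := ∑ σ, jetMul (varTheta σ (bivector B b)) ∘ₗ gradU σ with hV
  have hV' : ∀ f, ∑ σ, jetMul (varTheta σ (bivector B b)) (gradU σ f) = V f := by
    intro f; simp [hV, LinearMap.sum_apply]
  -- The vector field `V` acts only on the coefficient, with factor 2 from `jetMul_hatEmb`; the sign
  -- comes from exchanging the two odd factors. Together with the 2 of `functionalBracket_self` this
  -- gives `-4`.
  have key : ∀ (α β : Fin N) (p : ℕ →₀ L),
      V (theta (α, 0) * applyTo (hatEmb b) (theta (β, 0)) p) =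
        (-2 : ℂ) • (applyTo (hamiltonian b B) (theta (β, 0)) p * theta (α, 0)) := by
    intro α β p
    induction p using Finsupp.induction_linear with
    | zero => simp
    | add p q hp hq => simp only [map_add, mul_add, add_mul, smul_add, hp, hq]
    | single n x =>
      rw [applyTo_single, applyTo_single, hatDer_pow_theta, ← mul_assoc, hatEmb_apply,
        ← ofArc_mul_comm, mul_assoc, ← hV']
      have h0 : ∀ i, dU i (theta (α, 0) * theta (β, n)) = 0 := by
        intro i
        simp [dU_mul, dU_theta]
      simp only [gradU_mul_of_dU_eq_zero _ _ _ h0, jetMul_coeffwise_mulRight, ← Finset.sum_mul,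
        ← hatEmb_apply, hB.jetMul_hatEmb]
      rw [theta_mul_theta, hat_mul_neg, smul_mul_assoc, mul_assoc]
      module
  rw [hV', bivector_eq, map_sum, trivector, map_sum, map_sum, Finset.smul_sum, Finset.smul_sum]
  refine Finset.sum_congr rfl fun α _ => ?_
  rw [map_sum, map_sum, map_sum, Finset.smul_sum, Finset.smul_sum]
  refine Finset.sum_congr rfl fun β _ => ?_
  rw [key, map_smul, smul_smul]
  norm_num

theorem euler_trivector : euler N (trivector b B) = (3 : ℂ) • trivector b B := by
  suffices trivector b B ∈ LinearMap.eqLocus (euler N) ((3 : ℂ) • LinearMap.id) from this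
  set S := LinearMap.eqLocus (euler N) ((3 : ℂ) • LinearMap.id)
  have h1 : ∀ x j k, hamiltonian b B x * (theta j * theta k) ∈ S := by
    intro x j k
    rw [hamiltonian_apply, Finset.sum_mul]
    refine Submodule.sum_mem _ fun γ _ => ?_
    induction B (b γ) x using Finsupp.induction_linear with
    | zero => simp
    | add p q hp hq => rw [map_add, add_mul]; exact S.add_mem hp hq
    | single n x =>
      rw [applyTo_single, hatDer_pow_theta, hatEmb_apply, mul_assoc]
      exact euler_cubic _ _ _ _
  refine Submodule.sum_mem _ fun α _ => Submodule.sum_mem _ fun β _ => ?_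
  induction B (b β) (b α) using Finsupp.induction_linear with
  | zero => simp
  | add p q hp hq => rw [map_add, add_mul]; exact S.add_mem hp hq
  | single n x =>
    rw [applyTo_single, hatDer_pow_theta, mul_assoc]
    exact h1 _ _ _

/-- A total derivative has zero variational derivatives. Conversely the Euler operator, which
multiplies the cubic trivector by 3, is `∑ θ_σ δ/δθ_σ` under the integral. -/
theorem integral_trivector_eq_zero_iff :
    integral N (trivector b B) = 0 ↔ ∀ ρ, varTheta ρ (trivector b B) = 0 := by
  constructor
  · intro h ρ
    obtain ⟨f, hf⟩ := (Submodule.Quotient.mk_eq_zero _).1 h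
    rw [← hf, varTheta_hatDer]
  · intro h
    have := integral_euler (trivector b B)
    simp only [h, mul_zero, Finset.sum_const_zero, map_zero, euler_trivector, map_smul] at this
    exact (smul_eq_zero.1 this).resolve_left (by norm_num)

theorem varTheta_applyTo_mul (ρ γ : Fin N) (j k : Fin N × ℕ) (p : ℕ →₀ L) :
    varTheta ρ (applyTo (hatEmb b) (theta (γ, 0)) p * (theta j * theta k)) =
      (if γ = ρ then adjointTo (hatEmb b) (theta j * theta k) p else 0) -
        (if j.1 = ρ then
          ((-hatDer N) ^ j.2) (applyTo (hatEmb b) (theta (γ, 0)) p * theta k) else 0) +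
        (if k.1 = ρ then
          ((-hatDer N) ^ k.2) (applyTo (hatEmb b) (theta (γ, 0)) p * theta j) else 0) := by
  induction p using Finsupp.induction_linear with
  | zero => simp
  | add p q hp hq =>
    simp only [map_add, add_mul, hp, hq]
    split_ifs <;> abel
  | single n x =>
    simp only [applyTo_single, adjointTo_single, hatDer_pow_theta, hatEmb_apply, varTheta,
      LinearMap.comp_apply, mul_assoc, gradTheta_ofArc_mul, gradTheta_theta_mul, gradTheta_theta]
    split_ifs <;> simp [coeffwise_single, subst_single, hat_neg_mul, sub_eq_add_neg, add_assoc,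
      -Finsupp.single_mul]

theorem IsSkewSesquilinear.varTheta_hamiltonian_mul (hB : IsSkewSesquilinear B) (ρ : Fin N)
    (j k : Fin N × ℕ) (x : L) :
    varTheta ρ (hamiltonian b B x * (theta j * theta k)) =
      -applyTo (hatEmb b) (theta j * theta k) (B x (b ρ)) -
        (if j.1 = ρ then ((-hatDer N) ^ j.2) (hamiltonian b B x * theta k) else 0) +
        (if k.1 = ρ then ((-hatDer N) ^ k.2) (hamiltonian b B x * theta j) else 0) := by
  classical
  rw [hamiltonian_apply]
  simp only [Finset.sum_mul, map_sum, varTheta_applyTo_mul, Finset.sum_add_distrib,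
    Finset.sum_sub_distrib, Finset.sum_ite_eq', Finset.mem_univ, if_true,
    hB.adjointTo_eq (hatEmb_transl b)]
  split_ifs <;> simp

/-- One term for each of the three odd factors. The one hidden in `hamiltonian` yields the middle
Jacobi term, by skew-adjointness and the Leibniz rule for `λ + μ`. -/
theorem IsSkewSesquilinear.varTheta_applyTo_hamiltonian (hB : IsSkewSesquilinear B)
    (ρ α β : Fin N) (q : ℕ →₀ L) :
    varTheta ρ (applyTo (hamiltonian b B) (theta (β, 0)) q * theta (α, 0)) =
      -applyTo₂ (hatEmb b) (theta (β, 0)) (theta (α, 0)) (jacobiMid B (b ρ) q) -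
        (if β = ρ then adjointTo (hamiltonian b B) (theta (α, 0)) q else 0) +
        (if α = ρ then applyTo (hamiltonian b B) (theta (β, 0)) q else 0) := by
  induction q using Finsupp.induction_linear with
  | zero => simp [jacobiMid]
  | add p q hp hq =>
    have hm : jacobiMid B (b ρ) (p + q) = jacobiMid B (b ρ) p + jacobiMid B (b ρ) q := by
      simp [jacobiMid]
    simp only [map_add, add_mul, hp, hq, hm]
    split_ifs <;> abel
  | single n x =>
    rw [applyTo_single, applyTo₂_jacobiMid_single, hatDer_pow_theta, mul_assoc,
      hB.varTheta_hamiltonian_mul, adjointTo_single]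
    simp

theorem applyTo₂_swapVar (γ β : Fin N) (p : ℕ →₀ ℕ →₀ L) :
    applyTo₂ (hatEmb b) (theta (γ, 0)) (theta (β, 0)) (swapVar L p) =
      -applyTo₂ (hatEmb b) (theta (β, 0)) (theta (γ, 0)) p := by
  have : applyTo₂ (hatEmb b) (theta (γ, 0)) (theta (β, 0)) ∘ₗ swapVar L =
      -applyTo₂ (hatEmb b) (theta (β, 0)) (theta (γ, 0)) := by
    ext m n x
    simp only [LinearMap.comp_apply, Finsupp.lsingle_apply, swapVar_single, applyTo₂_single,
      applyTo_single, hatDer_pow_theta, mul_assoc, LinearMap.neg_apply]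
    rw [theta_mul_theta, hat_mul_neg]
  exact DFunLike.congr_fun this p

theorem sum_applyTo₂_jacobiLeft (β : Fin N) (q : ℕ →₀ L) :
    ∑ γ, applyTo₂ (hatEmb b) (theta (γ, 0)) (theta (β, 0)) (jacobiLeft B (b γ) q) =
      applyTo (hamiltonian b B) (theta (β, 0)) q := by
  simp only [jacobiLeft]
  induction q using Finsupp.induction_linear with
  | zero => simp
  | add p q hp hq => simp only [map_add, Finset.sum_add_distrib, hp, hq]
  | single n x =>
    simp only [coeffwise_single, applyTo₂_single, applyTo_single, hamiltonian_apply,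
      Finset.sum_mul]

/-- The variational derivatives of the trivector are given by the Jacobiator. -/
theorem IsSkewSesquilinear.varTheta_trivector (hB : IsSkewSesquilinear B) (ρ : Fin N) :
    varTheta ρ (trivector b B) = ∑ γ, ∑ β, applyTo₂ (hatEmb b) (theta (γ, 0)) (theta (β, 0))
      (jacobiator B (b γ) (b β) (b ρ)) := by
  classical
  have hK : ∑ γ, ∑ β, applyTo₂ (hatEmb b) (theta (γ, 0)) (theta (β, 0))
      (jacobiLeft B (b γ) (B (b β) (b ρ))) =
      ∑ β, applyTo (hamiltonian b B) (theta (β, 0)) (B (b β) (b ρ)) := by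
    rw [Finset.sum_comm]
    exact Finset.sum_congr rfl fun β _ => sum_applyTo₂_jacobiLeft b β _
  -- The right term is the left one with variables exchanged, and the odd factors anticommute. So
  -- left minus right is twice the sum in `hK`, matching the two remaining contributions to the
  -- variational derivative.
  have hK' : ∑ γ, ∑ β, applyTo₂ (hatEmb b) (theta (γ, 0)) (theta (β, 0))
      (jacobiRight B (b β) (B (b γ) (b ρ))) =
      -∑ β, applyTo (hamiltonian b B) (theta (β, 0)) (B (b β) (b ρ)) := by
    simp only [jacobiRight_eq_swapVar, applyTo₂_swapVar, Finset.sum_neg_distrib,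
      sum_applyTo₂_jacobiLeft]
  simp only [trivector, map_sum, hB.varTheta_applyTo_hamiltonian, jacobiator, map_sub, map_add,
    Finset.sum_add_distrib, Finset.sum_sub_distrib, hK, hK', Finset.sum_neg_distrib,
    Finset.sum_ite_eq', Finset.mem_univ, if_true, hB.adjointTo_eq (hB.hamiltonian_transl b)]
  rw [Finset.sum_comm (f := fun α β => applyTo₂ (hatEmb b) (theta (β, 0)) (theta (α, 0))
    (jacobiMid B (b ρ) (B (b β) (b α)))),
    Finset.sum_comm (f := fun α β => if α = ρ then
      applyTo (hamiltonian b B) (theta (β, 0)) (B (b β) (b α)) else 0)]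
  simp only [Finset.sum_ite_eq', Finset.mem_univ, if_true]
  abel

theorem dTheta_dTheta_theta_mul_theta (i j k l : Fin N × ℕ) (p : ArcAlg N) :
    dTheta j (dTheta i (ofArc N p * (theta k * theta l))) =
      (if k = i ∧ l = j then ofArc N p else 0) - (if k = j ∧ l = i then ofArc N p else 0) := by
  have h : dTheta j (dTheta i (theta k * theta l)) =
      (if k = i ∧ l = j then 1 else 0) - (if k = j ∧ l = i then 1 else 0) := by
    rw [dTheta_theta_mul, dTheta_theta, map_sub, apply_ite (dTheta j), map_zero, dTheta_theta,
      mul_ite, mul_one, mul_zero, apply_ite (dTheta j), map_zero, dTheta_theta, ← ite_and,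
      ← ite_and]
    exact congrArg _ (if_congr and_comm rfl rfl)
  rw [dTheta_ofArc_mul, dTheta_ofArc_mul, h, hat_mul_sub, mul_ite, mul_ite, mul_one, mul_zero]

/-- Second odd derivatives read off a single coefficient, up to the antisymmetrised one in which the
two odd factors trade places. -/
theorem dTheta_dTheta_applyTo₂ (γ β γ' β' : Fin N) (m n : ℕ) (p : ℕ →₀ ℕ →₀ L) :
    dTheta (β, m) (dTheta (γ, n) (applyTo₂ (hatEmb b) (theta (γ', 0)) (theta (β', 0)) p)) =
      (if γ' = γ ∧ β' = β then hatEmb b (p m n) else 0) -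
        (if γ' = β ∧ β' = γ then hatEmb b (p n m) else 0) := by
  induction p using Finsupp.induction_linear with
  | zero => simp
  | add p q hp hq =>
    simp only [map_add, hp, hq, Finsupp.add_apply]
    split_ifs <;> abel
  | single k p =>
    rw [applyTo₂_single]
    induction p using Finsupp.induction_linear with
    | zero => simp
    | add p q hp hq =>
      simp only [map_add, add_mul, hp, hq, Finsupp.add_apply, Finsupp.single_add]
      split_ifs <;> abel
    | single l x =>
      have hs : ∀ m n : ℕ, Finsupp.single k (Finsupp.single l x) m n =
          if k = m ∧ l = n then x else 0 := by
        classical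
        intro m n
        by_cases hk : k = m <;> simp [hk, Finsupp.single_apply]
      rw [applyTo_single, hatDer_pow_theta, hatDer_pow_theta, mul_assoc, hatEmb_apply,
        dTheta_dTheta_theta_mul_theta, ← hatEmb_apply, hs, hs, apply_ite (hatEmb b),
        apply_ite (hatEmb b), map_zero, ← ite_and, ← ite_and]
      congr 1 <;> refine if_congr ?_ rfl rfl <;> simp only [Prod.mk.injEq] <;> tauto

theorem IsSkewSesquilinear.sum_applyTo₂_jacobiator_eq_zero_iff (hB : IsSkewSesquilinear B)
    (ρ : Fin N) :
    ∑ γ, ∑ β, applyTo₂ (hatEmb b) (theta (γ, 0)) (theta (β, 0))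
      (jacobiator B (b γ) (b β) (b ρ)) = 0 ↔ ∀ γ β, jacobiator B (b γ) (b β) (b ρ) = 0 := by
  classical
  refine ⟨fun h γ β => ?_, fun h => by simp [h]⟩
  ext m n
  have h' := congrArg (fun f => dTheta (β, m) (dTheta (γ, n) f)) h
  simp only [map_sum, dTheta_dTheta_applyTo₂, map_zero, Finset.sum_sub_distrib] at h'
  -- Skew-symmetry of the Jacobiator makes the subtracted coefficient the negative of the wanted
  -- one, so they add up to twice it instead of cancelling.
  simp only [ite_and, Finset.sum_ite_eq', Finset.sum_ite_irrel, Finset.sum_const_zero,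
    Finset.mem_univ, if_true, hB.jacobiator_swap (b γ) (b β) (b ρ), Finsupp.neg_apply,
    swapVar_apply, map_neg, sub_neg_eq_add, ← map_add] at h'
  have h2 := hatEmb_injective b (h'.trans (map_zero _).symm)
  rw [← two_smul ℂ] at h2
  exact (smul_eq_zero.1 h2).resolve_left two_ne_zero

theorem IsSkewSesquilinear.isLieConformal_iff_functionalBracket (hB : IsSkewSesquilinear B) :
    IsLieConformal B ↔
      functionalBracket N (integral N (bivector B b)) (integral N (bivector B b)) = 0 := by
  rw [hB.functionalBracket_bivector, smul_eq_zero_iff_right (by norm_num),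
    integral_trivector_eq_zero_iff, hB.isLieConformal_iff b]
  simp only [hB.varTheta_trivector, hB.sum_applyTo₂_jacobiator_eq_zero_iff]
  exact ⟨fun h ρ γ β => h γ β ρ, fun h γ β ρ => h ρ γ β⟩

end Cubic

end ConformalR

end

/-! ### Assembly of the four statements. -/

open ConformalR in
theorem mainTheorem3 {L : Type*} [AddCommGroup L] [Module ℂ L] [Module (Polynomial ℂ) L]
    [IsScalarTower ℂ (Polynomial ℂ) L]
    (B : L →ₗ[ℂ] L →ₗ[ℂ] (ℕ →₀ L)) (hB : IsLieConformal B)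
    {N : ℕ} (b : Module.Basis (Fin N) (Polynomial ℂ) L)
    (R : L →ₗ[ℂ] L) (hR : ∀ a, R (transl L a) = transl L (R a)) :
    (∃ e : SymmetricAlgebra ℂ L ≃ₐ[ℂ] ArcAlg N,
      (∀ a, e (SymmetricAlgebra.ι ℂ L a) = jetEmb b a) ∧
      ∀ v, e (symDer L v) = arcDer N (e v)) ∧
    (∀ a a', pvaBracket B b (jetEmb b a) (jetEmb b a') = coeffwise (jetEmb b) (B a a')) ∧
    (∀ κ : ℂ, ModifiedCYBE κ B R → IsClassicalRMatrix B R) ∧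
    bivector (bracketR B R) b ∈ hatDeg N 2 ∧
    (IsClassicalRMatrix B R ↔
      functionalBracket N (integral N (bivector (bracketR B R) b))
        (integral N (bivector (bracketR B R) b)) = 0) ∧
    functionalBracket N (integral N (bivector B b)) (integral N (bivector B b)) = 0 ∧
    (IsClassicalRMatrix B R ↔
      IsMaurerCartan (integral N (bivector B b))
        (integral N (bivector (bracketR B R) b - bivector B b))) := by
  have hS := hB.isSkewSesquilinear
  have hSR := hS.bracketR hR
  have hP := (hS.isLieConformal_iff_functionalBracket b).1 hB
  have hPR : IsClassicalRMatrix B R ↔ _ := hSR.isLieConformal_iff_functionalBracket b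
  refine ⟨exists_symmetricAlgebra_equiv b, pvaBracket_jetEmb hB.sesq_left hB.sesq_right b,
    fun κ h => h.isClassicalRMatrix hB hR, bivector_mem_hatDeg b _, hPR, hP, ?_⟩
  have hdeg : integral N (bivector (bracketR B R) b - bivector B b) ∈ functionalDeg N 2 :=
    ⟨_, (hatDeg N 2).sub_mem (bivector_mem_hatDeg b _) (bivector_mem_hatDeg b _), rfl⟩
  have hcomm : functionalBracket N (integral N (bivector (bracketR B R) b))
      (integral N (bivector B b)) = functionalBracket N (integral N (bivector B b))
      (integral N (bivector (bracketR B R) b)) :=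
    functionalBracket_comm (parity_bivector b _) (parity_bivector b _) (commute_bivector b _)
      (commute_bivector b _)
  -- In the expansion `[∫P, ∫P]` vanishes, and the cross term `[∫P, ∫P_R]` from the differential
  -- cancels the two halves from the quadratic part.
  have hmc : functionalBracket N (integral N (bivector B b))
        (integral N (bivector (bracketR B R) b - bivector B b)) + (1 / 2 : ℂ) •
        functionalBracket N (integral N (bivector (bracketR B R) b - bivector B b))
        (integral N (bivector (bracketR B R) b - bivector B b)) =
      (1 / 2 : ℂ) • functionalBracket N (integral N (bivector (bracketR B R) b))
        (integral N (bivector (bracketR B R) b)) := by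
    rw [map_sub (integral N)]
    simp only [map_sub, LinearMap.sub_apply, hcomm, hP]
    module
  rw [hPR, IsMaurerCartan, hmc, smul_eq_zero_iff_right (by norm_num)]
  exact (and_iff_right hdeg).symm
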